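/- Let $\Bbbk$ be an algebraically closed field and $\mathcal X$ a spherical semisimple multitensor category over $\Bbbk$: a locally finite $\Bbbk$-linear abelian category in which every object is a finite direct sum of simple objects, with a rigid monoidal structure bilinear on morphisms and a pivotal structure (a monoidal natural isomorphism $x\cong x^{**}$). Let $\Gamma$ be the set of primitive idempotents of $\operatorname{End}(\mathbf 1)$, $\mathbf 1=\bigoplus_{i\in\Gamma}\mathbf 1_i$, and let $\mathcal X_{ij}$ consist of the objects $x\cong\mathbf 1_i\otimes x\otimes\mathbf 1_j$, $\mathcal X_i=\mathcal X_{ii}$. Spherical means that for every endomorphism $f$ of an object of $\mathcal X_{ij}$ the right and the left trace are equal as scalars under $\operatorname{End}(\mathbf 1_i)\cong\Bbbk\cong\operatorname{End}(\mathbf 1_j)$; write $\operatorname{tr}_x(f)$ for this scalar, and $d_x=\operatorname{tr}_x(\mathrm{id}_x)$. Write $\bar x$ for the dual of $x$, and $\langle x_1\cdots x_n\rangle$ for the vector space $\operatorname{Hom}(\mathbf 1,x_1\otimes\cdots\otimes x_n)$, identified with $\langle x_2\cdots x_nx_1\rangle$ by $f\mapsto(\mathrm{ev}_{x_1}\otimes\mathrm{id})\circ(\mathrm{id}\otimes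 f\otimes\mathrm{id})\circ\overline{\mathrm{coev}}_{x_1}$, and let $\circ_b\colon\langle x\bar b\rangle\otimes\langle by\rangle\to\langle xy\rangle$, $f\circ_b g=(\mathrm{id}\otimes\mathrm{ev}_b\otimes\mathrm{id})\circ(f\otimes g)$. Fix representatives $\operatorname{Irr}\mathcal X_{ij}$ of the isomorphism classes of simple objects of each $\mathcal X_{ij}$, put $\operatorname{Irr}\mathcal X=\coprod_{i,j}\operatorname{Irr}\mathcal X_{ij}$, and let $J=\coprod_{i,j} J_{ij}$ where $J_{ij}$ is a set of objects of $\mathcal X_{ij}$ containing $\operatorname{Irr}\mathcal X_{ij}$. For objects $a,b$ put $$T^J_{a;b}=\bigoplus_{x\in J}\langle\bar b\,\bar x\,a\,x\rangle .$$ For $f\in\langle\bar b\bar xax\rangle$ and $g\in\langle\bar c\bar yby\rangle$ with $x,y\in J$, the welding $w(f\otimes g)=\star_{xy}(f\circ_b g)\in T^J_{a;c}$ is the element whose component at $t\in\operatorname{Irr}\mathcal X$ is $$d_xd_y\sum_p \big(\text{the gluing of }f\circ_b g\in\langle \bar c\,\overline{xy}\,a\,xy\rangle\text{ with }\alpha^p\text{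 along }\overline{xy}\text{ and with }\bar\alpha_p\text{ along }xy\big)\in\langle\bar c\,\bar t\,a\,t\rangle ,$$ where $(\alpha^p)$, $(\bar\alpha_p)$ are bases of $\langle xy\bar t\rangle$ and $\langle t\,\overline{xy}\rangle$ dual with respect to the pairing $\langle\bar\alpha,\alpha\rangle=\operatorname{tr}_t(\bar\alpha\circ_{xy}\alpha)$, and whose other components are $0$. Such dual bases exist, the component does not depend on their choice, only finitely many components are nonzero, and $w$ extends to a linear map $w\colon T^J_{a;b}\otimes T^J_{b;c}\to T^J_{a;c}$. (1) Welding is associative: $w(w(f\otimes g)\otimes h)=w(f\otimes w(g\otimes h))$ for all objects $a,b,c,d$ and all $f\in T^J_{a;b}$, $g\in T^J_{b;c}$, $h\in T^J_{c;d}$. (2) Let $I=\coprod_i I_i$ where $I_i$ is a set of objects of $\mathcal X_i$ (for instance, a set of representatives of isomorphism classes that contains $\operatorname{Irr}\mathcal X_i$). Then $$\mathrm{Tube}(\mathcal X,I)=\bigoplus_{a,b\in I}T_{a;b},\qquad T_{a;b}=T^{\operatorname{Irr}\mathcal X}_{a;b},$$ with the product given by welding $T_{a;b}\otimes T_{b;c}\to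 T_{a;c}$ and by zero on $T_{a;b}\otimes T_{b';c}$ for $b\ne b'$, is an associative $\Bbbk$-algebra with local units: the product is associative, and every finite-dimensional subspace $V$ is contained in $eAe$ for some idempotent $e\in A=\mathrm{Tube}(\mathcal X,I)$. The local units are the elements $e_F=\sum_{a\in F}e_a$, for finite $F\subset I$, where for $a\in I_i$ the element $e_a\in\langle\bar a\,a\rangle\cong\langle\bar a\,\bar u_i\,a\,u_i\rangle$ is given by $\overline{\mathrm{coev}}_a$, with $u_i\in\operatorname{Irr}\mathcal X_{ii}$ the representative of $\mathbf 1_i$: every $e_F$ is idempotent, $f\mapsto e_F\cdot f\cdot e_F$ is the projection of $\mathrm{Tube}(\mathcal X,I)$ onto $\bigoplus_{a,b\in F}T_{a;b}$, and for every finite-dimensional subspace $V$ there is a finite $F$ with $e_F\cdot v\cdot e_F=v$ for all $v\in V$. -/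

import Mathlib

open CategoryTheory CategoryTheory.Limits MonoidalCategory
open scoped DirectSum

universe u v w

noncomputable section

namespace TubeAlg

attribute [local instance] Abelian.hasFiniteBiproducts

/-! Linear-categorical assumptions -/

/-- A `k`-linear abelian category is locally finite when its morphism spaces are finite
dimensional and every object has finite length. -/
class LocallyFiniteCategory (k : Type w) [Field k] (C : Type u) [Category.{v} C] [Abelian C]
    [Linear k C] : Prop where
  finite_hom : ∀ X Y : C, FiniteDimensional k (X ⟶ Y)
  noetherian : ∀ X : C, IsNoetherianObject X
  artinian : ∀ X : C, IsArtinianObject X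

/-- Every object is a finite direct sum of simple objects. -/
class SemisimpleCategory (C : Type u) [Category.{v} C] [Abelian C] : Prop where
  exists_simples : ∀ X : C, ∃ (n : ℕ) (S : Fin n → C),
    (∀ m, Simple (S m)) ∧ Nonempty (X ≅ ⨁ S)

/-- A pivotal structure: a monoidal natural isomorphism from the identity functor to the double
dual functor. Here `Xᘁ` is the dual with `η_ X Xᘁ : 𝟙 ⟶ X ⊗ Xᘁ` and `ε_ X Xᘁ : Xᘁ ⊗ X ⟶ 𝟙`.
(Compatibility with the unit object follows from `tensor`, all components being invertible.) -/
class PivotalCategory (C : Type u) [Category.{v} C] [MonoidalCategory C]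
    [RightRigidCategory C] where
  iso : ∀ X : C, X ≅ (Xᘁ)ᘁ
  naturality : ∀ {X Y : C} (f : X ⟶ Y), f ≫ (iso Y).hom = (iso X).hom ≫ (fᘁ)ᘁ
  tensor : ∀ X Y : C,
    (iso (X ⊗ Y)).hom ≫ ((rightDualTensorIso X Y).inv)ᘁ ≫ (rightDualTensorIso Yᘁ Xᘁ).hom =
      (iso X).hom ⊗ₘ (iso Y).hom

/-! The components of the unit object -/

section Unit

variable (C : Type u) [Category.{v} C] [Abelian C] [MonoidalCategory C]

/-- The set `Γ` of primitive idempotents of the (commutative) ring `End(𝟙)`. -/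
def Gam : Type v :=
  {e : 𝟙_ C ⟶ 𝟙_ C // e ≫ e = e ∧ e ≠ 0 ∧
    ∀ f : 𝟙_ C ⟶ 𝟙_ C, f ≫ f = f → f ≫ e = f → e ≫ f = f → f = 0 ∨ f = e}

variable {C}

/-- The component `𝟙_i` of the unit object: the image of the idempotent `i`. -/
def unitObj (i : Gam C) : C := image i.1

def unitIncl (i : Gam C) : unitObj i ⟶ 𝟙_ C := image.ι i.1

def unitProj (i : Gam C) : 𝟙_ C ⟶ unitObj i := factorThruImage i.1

@[simp] lemma unitProj_incl (i : Gam C) : unitProj i ≫ unitIncl i = i.1 := image.fac i.1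

instance (i : Gam C) : Mono (unitIncl i) := inferInstanceAs (Mono (image.ι i.1))
instance (i : Gam C) : Epi (unitProj i) := inferInstanceAs (Epi (factorThruImage i.1))

@[simp] lemma unitIncl_proj (i : Gam C) : unitIncl i ≫ unitProj i = 𝟙 (unitObj i) := by
  rw [← cancel_epi (unitProj i), ← cancel_mono (unitIncl i)]
  have h := i.2.1
  simp only [Category.assoc, unitProj_incl, Category.comp_id]
  rw [← Category.assoc, unitProj_incl, h]

/-- The only idempotents of `End(𝟙_i)` are `0` and `1`. -/
lemma unitObj_idem (i : Gam C) (f : unitObj i ⟶ unitObj i) (hf : f ≫ f = f) :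
    f = 0 ∨ f = 𝟙 _ := by
  have key : ∀ g : unitObj i ⟶ unitObj i,
      unitIncl i ≫ (unitProj i ≫ g ≫ unitIncl i) ≫ unitProj i = g := by
    intro g
    simp only [Category.assoc, unitIncl_proj, Category.comp_id]
    rw [← Category.assoc, unitIncl_proj, Category.id_comp]
  have h1 : unitIncl i ≫ i.1 = unitIncl i := by
    rw [← unitProj_incl, ← Category.assoc, unitIncl_proj, Category.id_comp]
  have h2 : i.1 ≫ unitProj i = unitProj i := by
    rw [← unitProj_incl, Category.assoc, unitIncl_proj, Category.comp_id]
  rcases i.2.2.2 (unitProj i ≫ f ≫ unitIncl i) (by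
      simp only [Category.assoc]
      rw [← Category.assoc (unitIncl i), unitIncl_proj, Category.id_comp, ← Category.assoc f f,
        hf]) (by simp [h1]) (by rw [← Category.assoc, h2]) with h | h
  · left
    have := key f
    rw [h] at this
    simpa using this.symm
  · right
    have := key f
    rw [h, ← Category.assoc, h1, unitIncl_proj] at this
    exact this.symm

lemma unitObj_id_ne_zero (i : Gam C) : 𝟙 (unitObj i) ≠ 0 := by
  intro h
  apply i.2.2.1
  rw [← unitProj_incl, ← Category.comp_id (unitProj i), h]
  simp

instance unitObj_simple [SemisimpleCategory C] (i : Gam C) : Simple (unitObj i) := by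
  obtain ⟨n, S, hS, ⟨φ⟩⟩ := SemisimpleCategory.exists_simples (unitObj i)
  have hne := unitObj_id_ne_zero i
  -- some summand projection is nonzero, hence the identity
  have hex : ∃ m, φ.hom ≫ biproduct.π S m ≫ biproduct.ι S m ≫ φ.inv ≠ 0 := by
    by_contra hcon
    push Not at hcon
    apply hne
    have : φ.hom ≫ (∑ m, biproduct.π S m ≫ biproduct.ι S m) ≫ φ.inv = 0 := by
      simp only [Preadditive.sum_comp, Preadditive.comp_sum, Category.assoc]
      exact Finset.sum_eq_zero fun m _ => hcon m
    rw [biproduct.total] at this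
    simpa using this
  obtain ⟨m, hm⟩ := hex
  have hid := (unitObj_idem i (φ.hom ≫ biproduct.π S m ≫ biproduct.ι S m ≫ φ.inv)
    (by simp)).resolve_left hm
  have := hS m
  exact Simple.of_iso (Y := S m)
    ⟨φ.hom ≫ biproduct.π S m, biproduct.ι S m ≫ φ.inv, by simpa using hid, by simp⟩

/-- `X` lies in the component `C_{ij}`, that is `X ≅ 𝟙_i ⊗ X ⊗ 𝟙_j`. -/
def Homogeneous (i j : Gam C) (X : C) : Prop :=
  Nonempty (X ≅ unitObj i ⊗ (X ⊗ unitObj j))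

lemma unitObj_action (i : Gam C) :
    (ρ_ (unitObj i)).inv ≫ unitObj i ◁ i.1 ≫ (ρ_ (unitObj i)).hom = 𝟙 _ := by
  have h1 : unitIncl i ≫ i.1 = unitIncl i := by
    rw [← unitProj_incl, ← Category.assoc, unitIncl_proj, Category.id_comp]
  have h3 : 𝟙_ C ◁ i.1 = (ρ_ (𝟙_ C)).hom ≫ i.1 ≫ (ρ_ (𝟙_ C)).inv := by
    simp [unitors_equal, unitors_inv_equal]
  rw [← cancel_mono (unitIncl i)]
  calc ((ρ_ (unitObj i)).inv ≫ unitObj i ◁ i.1 ≫ (ρ_ (unitObj i)).hom) ≫ unitIncl i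
      = (ρ_ (unitObj i)).inv ≫ (unitObj i ◁ i.1 ≫ unitIncl i ▷ 𝟙_ C) ≫ (ρ_ (𝟙_ C)).hom := by
        simp
    _ = (ρ_ (unitObj i)).inv ≫ (unitIncl i ▷ 𝟙_ C ≫ 𝟙_ C ◁ i.1) ≫ (ρ_ (𝟙_ C)).hom := by
        rw [whisker_exchange]
    _ = unitIncl i ≫ i.1 := by rw [h3]; simp
    _ = 𝟙 _ ≫ unitIncl i := by rw [h1, Category.id_comp]

lemma homogeneous_unitObj (i : Gam C) : Homogeneous i i (unitObj i) := by
  have m : unitObj i ≅ unitObj i ⊗ unitObj i :=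
    { hom := (ρ_ _).inv ≫ unitObj i ◁ unitProj i
      inv := unitObj i ◁ unitIncl i ≫ (ρ_ _).hom
      hom_inv_id := by
        rw [Category.assoc, ← Category.assoc (unitObj i ◁ unitProj i),
          ← MonoidalCategory.whiskerLeft_comp, unitProj_incl, unitObj_action]
      inv_hom_id := by
        simp [← MonoidalCategory.whiskerLeft_comp] }
  exact ⟨m ≪≫ whiskerLeftIso (unitObj i) m⟩

variable (C) in
/-- Sets of representatives `Irr C_{ij}` of the isomorphism classes of simple objects of
`C_{ij}`. -/
structure SimpleReps where
  carrier : Gam C → Gam C → Set C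
  simple : ∀ {i j X}, X ∈ carrier i j → Simple X
  homogeneous : ∀ {i j X}, X ∈ carrier i j → Homogeneous i j X
  exists_unique : ∀ (i j : Gam C) (X : C), Simple X → Homogeneous i j X →
    ∃! Y, Y ∈ carrier i j ∧ Nonempty (X ≅ Y)

end Unit

/-! Scalars, traces, sphericality -/

section Scalars

variable (k : Type w) [Field k] [IsAlgClosed k]
variable {C : Type u} [Category.{v} C] [Abelian C] [Linear k C] [MonoidalCategory C]

lemma scalar_bijective [LocallyFiniteCategory k C] [SemisimpleCategory C] (i : Gam C) :
    Function.Bijective (LinearMap.toSpanSingleton k (unitObj i ⟶ unitObj i) (𝟙 (unitObj i))) := by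
  have := LocallyFiniteCategory.finite_hom (k := k) (unitObj i) (unitObj i)
  constructor
  · rw [← LinearMap.ker_eq_bot]
    exact LinearMap.ker_toSpanSingleton k (unitObj_id_ne_zero i)
  · intro f
    obtain ⟨c, hc⟩ := endomorphism_simple_eq_smul_id k f
    exact ⟨c, by simpa using hc⟩

/-- The identification `Hom(𝟙_i, 𝟙_i) ≅ k` with `id ↦ 1`. -/
def endUnitEquiv [LocallyFiniteCategory k C] [SemisimpleCategory C] (i : Gam C) :
    (unitObj i ⟶ unitObj i) ≃ₗ[k] k :=
  (LinearEquiv.ofBijective _ (scalar_bijective k i)).symm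

/-- The scalar of an endomorphism of `𝟙` at its component `i`. -/
def scalarAt [LocallyFiniteCategory k C] [SemisimpleCategory C] (i : Gam C) (c : 𝟙_ C ⟶ 𝟙_ C) : k :=
  endUnitEquiv k i (unitIncl i ≫ c ≫ unitProj i)

end Scalars

section Duality

variable {C : Type u} [Category.{v} C] [MonoidalCategory C] [RightRigidCategory C]
  [PivotalCategory C]

/-- The second evaluation `X ⊗ X̄ ⟶ 𝟙`. -/
def evBar (X : C) : X ⊗ Xᘁ ⟶ 𝟙_ C :=
  (PivotalCategory.iso X).hom ▷ Xᘁ ≫ ε_ Xᘁ ((Xᘁ)ᘁ)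

/-- The second coevaluation `𝟙 ⟶ X̄ ⊗ X`. -/
def coevBar (X : C) : 𝟙_ C ⟶ Xᘁ ⊗ X :=
  η_ Xᘁ ((Xᘁ)ᘁ) ≫ Xᘁ ◁ (PivotalCategory.iso X).inv

/-- The right trace. -/
def trR {X : C} (f : X ⟶ X) : 𝟙_ C ⟶ 𝟙_ C := η_ X Xᘁ ≫ f ▷ Xᘁ ≫ evBar X

/-- The left trace. -/
def trL {X : C} (f : X ⟶ X) : 𝟙_ C ⟶ 𝟙_ C := coevBar X ≫ Xᘁ ◁ f ≫ ε_ X Xᘁ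

/-! Spaces of morphisms bounded by a cyclic word. The space `H⟨x₁ ⋯ xₙ⟩`, the limit of the spaces
`Hom(𝟙, xᵢ ⋯ xₙ x₁ ⋯ xᵢ₋₁)` along the canonical isomorphisms between them, is represented by its
component `Hom(𝟙, x₁ ⊗ (x₂ ⊗ ⋯ ⊗ xₙ))` at the displayed starting point; changes of the starting
point are made by `rot`. -/

/-- The canonical isomorphism `Hom(𝟙, x y) ⟶ Hom(𝟙, y x)`,
`f ↦ (ev_x ⊗ id) ∘ (id ⊗ f ⊗ id) ∘ coevBar_x`. -/
def rot {X Y : C} (f : 𝟙_ C ⟶ X ⊗ Y) : 𝟙_ C ⟶ Y ⊗ X :=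
  coevBar X ⊗≫ Xᘁ ◁ f ▷ X ⊗≫ ε_ X Xᘁ ▷ (Y ⊗ X) ⊗≫ 𝟙 (Y ⊗ X)

/-- Composition relative to `b`: `H⟨X b̄⟩ ⊗ H⟨b Y⟩ ⟶ H⟨X Y⟩`,
`(f, g) ↦ (id ⊗ ev_b ⊗ id) ∘ (f ⊗ g)`. -/
def circ {X Y : C} (b : C) (f : 𝟙_ C ⟶ X ⊗ bᘁ) (g : 𝟙_ C ⟶ b ⊗ Y) : 𝟙_ C ⟶ X ⊗ Y :=
  (λ_ (𝟙_ C)).inv ≫ (f ⊗ₘ g) ⊗≫ X ◁ ε_ b bᘁ ▷ Y ⊗≫ 𝟙 (X ⊗ Y)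

/-- Composition relative to `b` in the presence of further edges `P` in front of `b`:
`H⟨X b̄⟩ ⊗ H⟨P b Y⟩ ⟶ H⟨P X Y⟩`. The disc `f` is inserted in front of the edge `b` of `g` and the
two edges labelled `b` are contracted with `ev_b`; for `P = 𝟙` this is `circ`, up to unit isomorphisms. -/
def circIn {P X Y : C} (b : C) (f : 𝟙_ C ⟶ X ⊗ bᘁ) (g : 𝟙_ C ⟶ P ⊗ (b ⊗ Y)) :
    𝟙_ C ⟶ P ⊗ (X ⊗ Y) :=
  g ⊗≫ P ◁ f ▷ (b ⊗ Y) ⊗≫ (P ⊗ X) ◁ ε_ b bᘁ ▷ Y ⊗≫ 𝟙 (P ⊗ (X ⊗ Y))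

/-- Composition relative to `b̄` in the presence of further edges `P` in front of `b̄`:
`H⟨X b⟩ ⊗ H⟨P b̄ Y⟩ ⟶ H⟨P X Y⟩`; the two edges labelled `b` are contracted with `evBar_b`. -/
def circInBar {P X Y : C} (b : C) (f : 𝟙_ C ⟶ X ⊗ b) (g : 𝟙_ C ⟶ P ⊗ (bᘁ ⊗ Y)) :
    𝟙_ C ⟶ P ⊗ (X ⊗ Y) :=
  g ⊗≫ P ◁ f ▷ (bᘁ ⊗ Y) ⊗≫ (P ⊗ X) ◁ evBar b ▷ Y ⊗≫ 𝟙 (P ⊗ (X ⊗ Y))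

/-- Composition relative to `b̄`: `H⟨X b⟩ ⊗ H⟨b̄ Y⟩ ⟶ H⟨X Y⟩`. -/
def circBar {X Y : C} (b : C) (f : 𝟙_ C ⟶ X ⊗ b) (g : 𝟙_ C ⟶ bᘁ ⊗ Y) : 𝟙_ C ⟶ X ⊗ Y :=
  (λ_ (𝟙_ C)).inv ≫ (f ⊗ₘ g) ⊗≫ X ◁ evBar b ▷ Y ⊗≫ 𝟙 (X ⊗ Y)

/-- The space `H⟨b̄ x̄ a x⟩` of tube elements. -/
abbrev TubeHom (a b x : C) : Type v := 𝟙_ C ⟶ bᘁ ⊗ (xᘁ ⊗ (a ⊗ x))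

/-- `f ∘_b g ∈ H⟨c̄ (x y)‾ a (x y)⟩` for `f ∈ H⟨b̄ x̄ a x⟩` and `g ∈ H⟨c̄ ȳ b y⟩`, where
`ȳ ⊗ x̄` is identified with the dual of `x ⊗ y`. -/
def glueTube {a b c x y : C} (f : TubeHom a b x) (g : TubeHom b c y) :
    TubeHom a c (x ⊗ y) :=
  circIn (P := cᘁ ⊗ yᘁ) b (rot f) (g ≫ (α_ cᘁ yᘁ (b ⊗ y)).inv) ⊗≫
    cᘁ ◁ (rightDualTensorIso x y).inv ▷ (a ⊗ (x ⊗ y))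

/-- For `F ∈ H⟨c̄ w̄ a w⟩`, the result in `H⟨c̄ t̄ a t⟩` of gluing `α ∈ H⟨w t̄⟩` along the edge `w̄`
and `β ∈ H⟨t w̄⟩` along the edge `w`. -/
def sandwich {a c x t : C} (α : 𝟙_ C ⟶ x ⊗ tᘁ) (β : 𝟙_ C ⟶ t ⊗ xᘁ)
    (F : TubeHom a c x) : TubeHom a c t :=
  circBar (X := cᘁ ⊗ (tᘁ ⊗ a)) x
    (circInBar (P := cᘁ) x (rot α) F ⊗≫ 𝟙 ((cᘁ ⊗ (tᘁ ⊗ a)) ⊗ x)) (rot β) ⊗≫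
      𝟙 (cᘁ ⊗ (tᘁ ⊗ (a ⊗ t)))

end Duality

section Linearity

variable (k : Type w) [Field k]
variable {C : Type u} [Category.{v} C] [Abelian C] [Linear k C] [MonoidalCategory C]
  [MonoidalPreadditive C] [MonoidalLinear k C] [RightRigidCategory C] [PivotalCategory C]

variable {k} in
lemma rot_smul {X Y : C} (r : k) (f : 𝟙_ C ⟶ X ⊗ Y) : rot (r • f) = r • rot f := by
  simp [rot, monoidalComp]

lemma rot_add {X Y : C} (f f' : 𝟙_ C ⟶ X ⊗ Y) : rot (f + f') = rot f + rot f' := by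
  simp [rot, monoidalComp]

/-- `glueTube` as a bilinear map. -/
def glueTubeLin (a b c x y : C) :
    TubeHom a b x →ₗ[k] TubeHom b c y →ₗ[k] TubeHom a c (x ⊗ y) :=
  LinearMap.mk₂ k glueTube
    (by intro f f' g; simp [glueTube, circIn, rot_add, monoidalComp])
    (by intro r f g; simp [glueTube, circIn, rot_smul, monoidalComp])
    (by intro f g g'; simp [glueTube, circIn, monoidalComp])
    (by intro r f g; simp [glueTube, circIn, monoidalComp])

/-- `sandwich` as a linear map. -/
def sandwichLin (a c : C) {x t : C} (α : 𝟙_ C ⟶ x ⊗ tᘁ) (β : 𝟙_ C ⟶ t ⊗ xᘁ) :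
    TubeHom a c x →ₗ[k] TubeHom a c t where
  toFun := sandwich α β
  map_add' F F' := by
    simp [sandwich, circBar, circInBar, monoidalComp, MonoidalCategory.tensorHom_def]
  map_smul' r F := by
    simp [sandwich, circBar, circInBar, monoidalComp, MonoidalCategory.tensorHom_def]

end Linearity

/-! Spherical categories, dual bases, welding -/

section Welding

variable (k : Type w) [Field k] [IsAlgClosed k]
variable (C : Type u) [Category.{v} C] [Abelian C] [Linear k C] [MonoidalCategory C]
  [MonoidalPreadditive C] [MonoidalLinear k C] [RightRigidCategory C]
  [LocallyFiniteCategory k C] [SemisimpleCategory C] [PivotalCategory C]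

/-- Left and right traces coincide as scalars on all homogeneous objects. -/
class SphericalCategory : Prop where
  trace_eq : ∀ (i j : Gam C) (X : C), Homogeneous i j X → ∀ f : X ⟶ X,
    scalarAt k i (trR f) = scalarAt k j (trL f)

variable {C}

/-- The dimension `d_x` of an object `x` of `C_{ij}`. -/
def dimAt (i : Gam C) (x : C) : k := scalarAt k i (trR (𝟙 x))

/-- The pairing `⟨β, α⟩ = tr_t(β ∘_x α)` of `H⟨t x̄⟩` with `H⟨x t̄⟩`, for `t` in `C_{ij}`. -/
def pairing (i : Gam C) {x t : C} (β : 𝟙_ C ⟶ t ⊗ xᘁ) (α : 𝟙_ C ⟶ x ⊗ tᘁ) : k :=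
  scalarAt k i (circ x β α ≫ evBar t)

/-- A pair of dual bases of `H⟨x t̄⟩`, for `t` in `C_{ij}`. -/
structure DualBases (i : Gam C) (x t : C) where
  n : ℕ
  α : Module.Basis (Fin n) k (𝟙_ C ⟶ x ⊗ tᘁ)
  β : Module.Basis (Fin n) k (𝟙_ C ⟶ t ⊗ xᘁ)
  dual : ∀ p q, pairing k i (β p) (α q) = if p = q then 1 else 0

variable {k} in
/-- Gluing a given pair of dual bases of `H⟨x t̄⟩` to the edges `x̄` and `x`. -/
def DualBases.resolve {i : Gam C} {x t : C} (B : DualBases k i x t) (a c : C) :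
    TubeHom a c x →ₗ[k] TubeHom a c t :=
  ∑ p, sandwichLin k a c (B.α p) (B.β p)

open Classical in
/-- The map `F ↦ ∑ αᵖ ∘ F ∘ βₚ` from `H⟨c̄ x̄ a x⟩` to `H⟨c̄ t̄ a t⟩`, with `(αᵖ), (βₚ)` some pair of
dual bases of `H⟨x t̄⟩`. -/
def resolveAt (i : Gam C) (a c x t : C) : TubeHom a c x →ₗ[k] TubeHom a c t :=
  if h : Nonempty (DualBases k i x t) then h.some.resolve a c else 0

/-- The disjoint union of a family of sets of homogeneous objects. -/
abbrev Label (J : Gam C → Gam C → Set C) : Type (max u v) := Σ (i : Gam C) (j : Gam C), J i j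

abbrev Label.obj {J : Gam C → Gam C → Set C} (x : Label J) : C := x.2.2.1

/-- The label of a larger family defined by a label of a smaller one. -/
def Label.incl {S J : Gam C → Gam C → Set C} (h : ∀ i j, S i j ⊆ J i j) (t : Label S) : Label J :=
  ⟨t.1, t.2.1, t.2.2.1, h _ _ t.2.2.2⟩

/-- The space of tubes from `b` to `a`. -/
abbrev TubeSpace (J : Gam C → Gam C → Set C) (a b : C) : Type (max u v) :=
  ⨁ x : Label J, TubeHom a b x.obj

/-- The component at the simple label `t` of the welding of `f ∈ H⟨b̄ x̄ a x⟩` and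
`g ∈ H⟨c̄ ȳ b y⟩`. The factor `d_x d_y` comes from the normalisation
`f •_{xy} g = √(d_x d_y) f ∘_{xy} g` of the two gluings along `x y`. -/
def weldAt {J : Gam C → Gam C → Set C} (i : Gam C) (a b c : C) (x y : Label J) (t : C) :
    TubeHom a b x.obj →ₗ[k] TubeHom b c y.obj →ₗ[k] TubeHom a c t :=
  (dimAt k x.1 x.obj * dimAt k y.1 y.obj) •
    (glueTubeLin k a b c x.obj y.obj).compr₂ (resolveAt k i a c (x.obj ⊗ y.obj) t)

open Classical in
/-- The welding `⋆_{xy}(f ∘_b g)` of `f ∈ H⟨b̄ x̄ a x⟩` and `g ∈ H⟨c̄ ȳ b y⟩`: the sum over all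
simple labels `t` of the components `weldAt` (only finitely many of them are nonzero). -/
def weldHom (S : SimpleReps C) {J : Gam C → Gam C → Set C} (h : ∀ i j, S.carrier i j ⊆ J i j)
    (a b c : C) (x y : Label J) :
    TubeHom a b x.obj →ₗ[k] TubeHom b c y.obj →ₗ[k] TubeSpace J a c :=
  ∑ᶠ t : Label S.carrier, (weldAt k t.1 a b c x y t.obj).compr₂
    (DirectSum.lof k (Label J) (fun z => TubeHom a c z.obj) (t.incl h))

open Classical in
/-- Welding of tube elements. -/
def weld (S : SimpleReps C) {J : Gam C → Gam C → Set C} (h : ∀ i j, S.carrier i j ⊆ J i j)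
    (a b c : C) : TubeSpace J a b →ₗ[k] TubeSpace J b c →ₗ[k] TubeSpace J a c :=
  DirectSum.toModule k (Label J) _ fun x =>
    (DirectSum.toModule k (Label J) _ fun y => (weldHom k S h a b c x y).flip).flip

/-! The tube algebra -/

/-- The disjoint union of a family of sets of objects of the diagonal components. -/
abbrev DiagLabel (I : Gam C → Set C) : Type (max u v) := Σ i : Gam C, I i

abbrev DiagLabel.obj {I : Gam C → Set C} (a : DiagLabel I) : C := a.2.1

/-- The underlying vector space of the tube algebra. -/
abbrev Tube (S : SimpleReps C) (I : Gam C → Set C) : Type (max u v) :=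
  ⨁ p : DiagLabel I × DiagLabel I, TubeSpace S.carrier p.1.obj p.2.obj

open Classical in
/-- The inclusion of `T_{a;b}` into the tube algebra. -/
def tubeIncl (S : SimpleReps C) (I : Gam C → Set C) (a b : DiagLabel I) :
    TubeSpace S.carrier a.obj b.obj →ₗ[k] Tube S I :=
  DirectSum.lof k (DiagLabel I × DiagLabel I)
    (fun p => TubeSpace S.carrier p.1.obj p.2.obj) (a, b)

open Classical in
/-- The product of `T_{a;b}` and `T_{b';c}` in the tube algebra: welding if `b = b'`, and zero
otherwise. -/
def tubeMulAt (S : SimpleReps C) (I : Gam C → Set C) (a b b' c : DiagLabel I) :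
    TubeSpace S.carrier a.obj b.obj →ₗ[k] TubeSpace S.carrier b'.obj c.obj →ₗ[k] Tube S I :=
  if h : b = b' then
    h ▸ (weld k S (fun _ _ => subset_rfl) a.obj b.obj c.obj).compr₂ (tubeIncl k S I a c)
  else 0

open Classical in
/-- The product of the tube algebra. -/
def tubeMul (S : SimpleReps C) (I : Gam C → Set C) : Tube S I →ₗ[k] Tube S I →ₗ[k] Tube S I :=
  DirectSum.toModule k _ _ fun p =>
    (DirectSum.toModule k _ _ fun q => (tubeMulAt k S I p.1 p.2 q.1 q.2).flip).flip

/-- The representative `u_i` of `𝟙_i` among the simple objects. -/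
def unitLabel (S : SimpleReps C) (i : Gam C) : Label S.carrier :=
  ⟨i, i, (S.exists_unique i i (unitObj i) inferInstance (homogeneous_unitObj i)).choose,
    (S.exists_unique i i (unitObj i) inferInstance (homogeneous_unitObj i)).choose_spec.1.1⟩

/-- An isomorphism `𝟙_i ≅ u_i`. -/
def unitLabelIso (S : SimpleReps C) (i : Gam C) : unitObj i ≅ (unitLabel S i).obj :=
  (S.exists_unique i i (unitObj i) inferInstance
    (homogeneous_unitObj i)).choose_spec.1.2.some

/-- The unit morphism `e_a`, given by `coevBar_a`, as an element of
`H⟨ā a⟩ = H⟨ā ū a u⟩`, where `φ : 𝟙_i ≅ u` (the result does not depend on the choice of `φ`). -/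
def unitHom (a : C) {i : Gam C} {u : C} (φ : unitObj i ≅ u) : TubeHom a a u :=
  coevBar a ⊗≫ aᘁ ◁ (coevBar u ≫ uᘁ ◁ (φ.inv ≫ unitIncl i)) ▷ a ⊗≫
    (aᘁ ⊗ (uᘁ ⊗ a)) ◁ (unitProj i ≫ φ.hom) ⊗≫ 𝟙 (aᘁ ⊗ (uᘁ ⊗ (a ⊗ u)))

open Classical in
/-- The element `e_a` of the tube algebra. -/
def tubeUnit (S : SimpleReps C) (I : Gam C → Set C) (a : DiagLabel I) : Tube S I :=
  tubeIncl k S I a a (DirectSum.lof k (Label S.carrier) (fun z => TubeHom a.obj a.obj z.obj)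
    (unitLabel S a.1) (unitHom a.obj (unitLabelIso S a.1)))

/-- The element `e_F = ∑_{a ∈ F} e_a` of the tube algebra. -/
def tubeUnitSum (S : SimpleReps C) (I : Gam C → Set C) (F : Finset (DiagLabel I)) : Tube S I :=
  ∑ a ∈ F, tubeUnit k S I a

end Welding

/-- An associative algebra with local units: a bilinear associative product on `A` such that
every finite dimensional subspace is contained in `e A e` for some idempotent `e`. -/
structure IsAlgebraWithLocalUnits {k : Type*} [Field k] {A : Type*} [AddCommGroup A] [Module k A]
    (mul : A →ₗ[k] A →ₗ[k] A) : Prop where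
  assoc : ∀ f g h : A, mul f (mul g h) = mul (mul f g) h
  local_units : ∀ V : Submodule k A, FiniteDimensional k V →
    ∃ e : A, mul e e = e ∧ ∀ v ∈ V, ∃ u : A, v = mul (mul e u) e

end TubeAlg

end

open TubeAlg

noncomputable section

namespace TubeAlg

attribute [local instance] Abelian.hasFiniteBiproducts

/-! Bending the two dual edges of a tube element in H⟨c̄ x̄ a x⟩ to the source turns it into a
morphism x ⊗ c ⟶ a ⊗ x (`untube`, injective). In this form gluing along b stacks two crossings: y
passes from c to b, then x from b to a (`untube_glueTube`). Gluing α and β to the two edges x̄ and x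
becomes conjugation F ↦ A ▷ c ≫ F ≫ a ◁ B with A : t ⟶ X and B : X ⟶ t (`untube_sandwich`). Pivotal
coherence goes into reaching this form: rotation and the second evaluation give the same transpose
(`ofPair_rot`), and the second evaluation of x ⊗ y is nested (`evBar_tensor`).

Dual bases enter only through the tensor ∑ Aₘ ⊗ Bₘ characterised by φ = ∑ tr(φ ≫ Bₘ) Aₘ for all φ :
t ⟶ X (`IsResolving`). Semisimplicity and d_t ≠ 0 make the trace pairing perfect. Hence dual bases
exist, the tensor is unique (`IsResolving.sum_eq`), and ∑_t d_t ∑_p βₚ ≫ αᵖ = id_X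
(`sum_dualBases_eq_id`).

For associativity, insert this identity of X = x ⊗ y, tensored with z. Resolving X to t and then t ⊗
z to s, with weight d_t and summed over t, is thus a resolution of X ⊗ z to s (`isResolving_map`).
Welding twice produces exactly the weight d_t, so each bracketing is d_x d_y d_z times a resolution
of the triple gluing, and the associator identifies the two gluings (`sum_weldAt_assoc`).

For the units, u ⊗ x ≅ x is simple when the components match. Resolving a simple x to itself
multiplies by d_x⁻¹, and d_u = 1, so the coefficient is d_u d_x d_x⁻¹ = 1. When the components do
not match, the space of tubes vanishes. The sums e_F then cut out corners of a matrix-like algebra,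
and finite supports give local units. -/

open ExactPairing

/-! ### Duality, transposition and pivotal coherence -/

section Duality

variable {C : Type u} [Category.{v} C] [MonoidalCategory C] [RightRigidCategory C]

/-- In an exact pairing of `X ≅ 𝟙` with `Y`, also `Y ≅ 𝟙`. -/
def unitDualIso {C : Type u} [Category.{v} C] [MonoidalCategory C] {X Y : C} [ExactPairing X Y]
    (e : X ≅ 𝟙_ C) : 𝟙_ C ≅ Y where
  hom := η_ X Y ≫ e.hom ▷ Y ≫ (λ_ Y).hom
  inv := (ρ_ Y).inv ≫ Y ◁ e.inv ≫ ε_ X Y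
  hom_inv_id := by
    calc _ = 𝟙 _ ⊗≫ η_ X Y ⊗≫ (e.hom ▷ (Y ⊗ 𝟙_ C) ≫ 𝟙_ C ◁ (Y ◁ e.inv ≫ ε_ X Y)) ⊗≫ 𝟙 _ := by
          monoidal
      _ = 𝟙 _ ⊗≫ (η_ X Y ▷ 𝟙_ C ≫ (X ⊗ Y) ◁ e.inv) ⊗≫ X ◁ ε_ X Y ⊗≫ e.hom ⊗≫ 𝟙 _ := by
          rw [← whisker_exchange]; monoidal
      _ = 𝟙 _ ⊗≫ e.inv ⊗≫ (η_ X Y ▷ X ⊗≫ X ◁ ε_ X Y) ⊗≫ e.hom ⊗≫ 𝟙 _ := by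
          rw [← whisker_exchange]; monoidal
      _ = 𝟙 _ ⊗≫ (e.inv ≫ e.hom) ⊗≫ 𝟙 _ := by rw [evaluation_coevaluation'']; monoidal
      _ = 𝟙 _ := by rw [e.inv_hom_id]; monoidal
  inv_hom_id := by
    have h : e.inv ▷ X ≫ X ◁ e.hom = (λ_ X).hom ≫ (ρ_ X).inv := by
      rw [← whisker_exchange]
      calc _ = 𝟙 _ ⊗≫ (e.hom ≫ e.inv) ⊗≫ 𝟙 _ := by monoidal
        _ = _ := by rw [e.hom_inv_id]; monoidal
    calc _ = 𝟙 _ ⊗≫ Y ◁ e.inv ⊗≫ (ε_ X Y ▷ 𝟙_ C ≫ 𝟙_ C ◁ (η_ X Y ≫ e.hom ▷ Y)) ⊗≫ 𝟙 _ := by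
          monoidal
      _ = 𝟙 _ ⊗≫ Y ◁ (e.inv ▷ 𝟙_ C ≫ X ◁ η_ X Y) ⊗≫ Y ◁ X ◁ e.hom ▷ Y ⊗≫ ε_ X Y ▷ Y ⊗≫ 𝟙 _ := by
          rw [← whisker_exchange]; monoidal
      _ = 𝟙 _ ⊗≫ Y ◁ η_ X Y ⊗≫ Y ◁ (e.inv ▷ X ≫ X ◁ e.hom) ▷ Y ⊗≫ ε_ X Y ▷ Y ⊗≫ 𝟙 _ := by
          rw [← whisker_exchange]; monoidal
      _ = 𝟙 _ ⊗≫ (Y ◁ η_ X Y ⊗≫ ε_ X Y ▷ Y) ⊗≫ 𝟙 _ := by rw [h]; monoidal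
      _ = _ := by rw [coevaluation_evaluation'']; monoidal

lemma unitDualIso_evaluation {C : Type u} [Category.{v} C] [MonoidalCategory C] {X Y : C}
    [ExactPairing X Y] (e : X ≅ 𝟙_ C) :
    (unitDualIso (Y := Y) e).hom ▷ X ≫ ε_ X Y = (λ_ X).hom ≫ e.hom := by
  dsimp only [unitDualIso]
  calc _ = η_ X Y ▷ X ⊗≫ (e.hom ▷ (Y ⊗ X) ≫ 𝟙_ C ◁ ε_ X Y) ⊗≫ 𝟙 _ := by monoidal
    _ = 𝟙 _ ⊗≫ (η_ X Y ▷ X ⊗≫ X ◁ ε_ X Y) ⊗≫ e.hom ⊗≫ 𝟙 _ := by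
        rw [← whisker_exchange]; monoidal
    _ = _ := by rw [evaluation_coevaluation'']; monoidal

/-- The comparison of duals is the mate of the identity between two choices of a dual of X ⊗ Y, so
it carries one evaluation to the other. -/
lemma rightDualTensorIso_inv_evaluation (X Y : C) :
    (rightDualTensorIso X Y).inv ▷ (X ⊗ Y) ≫ ε_ (X ⊗ Y) (X ⊗ Y)ᘁ =
      𝟙 _ ⊗≫ (Yᘁ : C) ◁ (ε_ X Xᘁ ▷ Y) ⊗≫ ε_ Y Yᘁ := by
  -- The two dual structures on the same object must be supplied by hand: the chosen one, and the
  -- nested pairing with Yᘁ ⊗ Xᘁ.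
  have h := @rightAdjointMate_comp_evaluation C _ _ (X ⊗ Y) (X ⊗ Y) ⟨(X ⊗ Y)ᘁ⟩
    (@HasRightDual.mk _ _ _ _ (Yᘁ ⊗ Xᘁ) ExactPairing.tensor) (𝟙 _)
  rw [MonoidalCategory.whiskerLeft_id, Category.id_comp] at h
  exact h

/-- The morphism `t ⟶ x` that corresponds to an element of `H⟨x t̄⟩`. -/
def ofPair {x t : C} (α : 𝟙_ C ⟶ x ⊗ tᘁ) : t ⟶ x :=
  (λ_ t).inv ≫ α ▷ t ≫ (α_ _ _ _).hom ≫ x ◁ ε_ t tᘁ ≫ (ρ_ x).hom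

/-- The element of `H⟨x t̄⟩` that corresponds to a morphism `t ⟶ x`. -/
def toPair {x t : C} (g : t ⟶ x) : 𝟙_ C ⟶ x ⊗ tᘁ := η_ t tᘁ ≫ g ▷ tᘁ

lemma ofPair_toPair {x t : C} (g : t ⟶ x) : ofPair (toPair g) = g := by
  rw [ofPair, toPair]
  calc _ = 𝟙 _ ⊗≫ η_ t tᘁ ▷ t ⊗≫ (g ▷ (tᘁ ⊗ t) ≫ x ◁ ε_ t tᘁ) ⊗≫ 𝟙 _ := by monoidal
    _ = 𝟙 _ ⊗≫ (η_ t tᘁ ▷ t ⊗≫ t ◁ ε_ t tᘁ) ⊗≫ g := by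
      rw [← whisker_exchange]; monoidal
    _ = _ := by rw [evaluation_coevaluation'']; monoidal

lemma toPair_ofPair {x t : C} (α : 𝟙_ C ⟶ x ⊗ tᘁ) : toPair (ofPair α) = α := by
  rw [ofPair, toPair]
  calc _ = 𝟙 _ ⊗≫ (𝟙_ C ◁ η_ t tᘁ ≫ α ▷ (t ⊗ tᘁ)) ⊗≫ x ◁ ε_ t tᘁ ▷ tᘁ ⊗≫ 𝟙 _ := by monoidal
    _ = α ⊗≫ x ◁ (tᘁ ◁ η_ t tᘁ ⊗≫ ε_ t tᘁ ▷ tᘁ) ⊗≫ 𝟙 _ := by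
      rw [whisker_exchange]; monoidal
    _ = _ := by rw [coevaluation_evaluation'']; monoidal

lemma circIn_eq {P X Y : C} (b : C) (f : 𝟙_ C ⟶ X ⊗ bᘁ) (g : 𝟙_ C ⟶ P ⊗ (b ⊗ Y)) :
    circIn b f g = g ≫ P ◁ (ofPair f ▷ Y) := by
  rw [circIn, ofPair]; monoidal

lemma circ_eq {X Y : C} (b : C) (f : 𝟙_ C ⟶ X ⊗ bᘁ) (g : 𝟙_ C ⟶ b ⊗ Y) :
    circ b f g = g ≫ ofPair f ▷ Y := by
  rw [circ, ofPair, MonoidalCategory.tensorHom_def']; monoidal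

/-- The zigzag identity recovers p from its pairing with X. This is how mates are computed below. -/
lemma ext_evaluation {X W : C} {p q : W ⟶ Xᘁ}
    (h : p ▷ X ≫ ε_ X Xᘁ = q ▷ X ≫ ε_ X Xᘁ) : p = q := by
  have key : ∀ p : W ⟶ Xᘁ, 𝟙 _ ⊗≫ W ◁ η_ X Xᘁ ⊗≫ (p ▷ X ≫ ε_ X Xᘁ) ▷ Xᘁ ⊗≫ 𝟙 _ = p := by
    intro p
    calc _ = 𝟙 _ ⊗≫ (W ◁ η_ X Xᘁ ≫ p ▷ (X ⊗ Xᘁ)) ⊗≫ ε_ X Xᘁ ▷ Xᘁ ⊗≫ 𝟙 _ := by monoidal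
      _ = p ⊗≫ ((Xᘁ : C) ◁ η_ X Xᘁ ⊗≫ ε_ X Xᘁ ▷ Xᘁ) ⊗≫ 𝟙 _ := by
          rw [whisker_exchange]; monoidal
      _ = p := by rw [coevaluation_evaluation'']; monoidal
  rw [← key p, h, key q]

variable [PivotalCategory C]

lemma evBar_naturality {X Y : C} (f : X ⟶ Y) :
    f ▷ Yᘁ ≫ evBar Y = X ◁ fᘁ ≫ evBar X := by
  have h := rightAdjointMate_comp_evaluation (fᘁ)
  rw [evBar, evBar, ← comp_whiskerRight_assoc, PivotalCategory.naturality, comp_whiskerRight,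
    Category.assoc, h, ← whisker_exchange_assoc]

/-- This is where monoidality of the pivotal structure enters. -/
lemma evBar_tensor (X Y : C) :
    (X ⊗ Y) ◁ (rightDualTensorIso X Y).inv ≫ evBar (X ⊗ Y) =
      𝟙 _ ⊗≫ X ◁ evBar Y ▷ Xᘁ ⊗≫ evBar X := by
  have ht := PivotalCategory.tensor X Y
  rw [← Category.assoc, ← Iso.eq_comp_inv] at ht
  have h := rightAdjointMate_comp_evaluation (rightDualTensorIso X Y).inv
  rw [evBar, whisker_exchange_assoc, ← h, ← comp_whiskerRight_assoc, ht, comp_whiskerRight,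
    Category.assoc, rightDualTensorIso_inv_evaluation, evBar, evBar,
    MonoidalCategory.tensorHom_def']
  calc _ = 𝟙 _ ⊗≫ (X ◁ (PivotalCategory.iso Y).hom ▷ Yᘁ ▷ Xᘁ) ⊗≫
      ((PivotalCategory.iso X).hom ▷ ((((Yᘁ : C)ᘁ) : C) ⊗ (Yᘁ : C)) ≫
        (((Xᘁ : C)ᘁ) : C) ◁ ε_ (Yᘁ : C) (((Yᘁ : C)ᘁ) : C)) ▷ (Xᘁ : C) ⊗≫ ε_ (Xᘁ : C) (((Xᘁ : C)ᘁ) : C) := by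
        monoidal
    _ = _ := by rw [← whisker_exchange]; monoidal

/-- The exact pairing of `x̄` with `x` given by the second evaluation and coevaluation. -/
@[reducible]
def barPairing (X : C) : ExactPairing Xᘁ X where
  coevaluation' := coevBar X
  evaluation' := evBar X
  coevaluation_evaluation' := by
    rw [coevBar, evBar]
    calc _ = 𝟙 _ ⊗≫ X ◁ η_ (Xᘁ : C) (((Xᘁ : C)ᘁ) : C) ⊗≫ (X ⊗ (Xᘁ : C)) ◁ (PivotalCategory.iso X).inv ⊗≫
          (PivotalCategory.iso X).hom ▷ ((Xᘁ : C) ⊗ X) ⊗≫ ε_ (Xᘁ : C) (((Xᘁ : C)ᘁ) : C) ▷ X ⊗≫ 𝟙 _ := by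
            monoidal
      _ = 𝟙 _ ⊗≫ X ◁ η_ (Xᘁ : C) (((Xᘁ : C)ᘁ) : C) ⊗≫ ((X ⊗ (Xᘁ : C)) ◁ (PivotalCategory.iso X).inv ≫
          (PivotalCategory.iso X).hom ▷ (Xᘁ : C) ▷ X) ⊗≫ ε_ (Xᘁ : C) (((Xᘁ : C)ᘁ) : C) ▷ X ⊗≫ 𝟙 _ := by
            monoidal
      _ = 𝟙 _ ⊗≫ (X ◁ η_ (Xᘁ : C) (((Xᘁ : C)ᘁ) : C) ≫
          (PivotalCategory.iso X).hom ▷ ((Xᘁ : C) ⊗ (((Xᘁ : C)ᘁ) : C))) ⊗≫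
          (((((Xᘁ : C)ᘁ) : C) ⊗ (Xᘁ : C)) ◁ (PivotalCategory.iso X).inv ≫ ε_ (Xᘁ : C) (((Xᘁ : C)ᘁ) : C) ▷ X) ⊗≫ 𝟙 _ := by
          rw [whisker_exchange]; monoidal
      _ = 𝟙 _ ⊗≫ (PivotalCategory.iso X).hom ▷ 𝟙_ C ⊗≫
          ((((Xᘁ : C)ᘁ) : C) ◁ η_ (Xᘁ : C) (((Xᘁ : C)ᘁ) : C) ⊗≫ ε_ (Xᘁ : C) (((Xᘁ : C)ᘁ) : C) ▷ (((Xᘁ : C)ᘁ) : C)) ⊗≫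
          (PivotalCategory.iso X).inv ⊗≫ 𝟙 _ := by
          rw [whisker_exchange, whisker_exchange]; monoidal
      _ = _ := by
          rw [coevaluation_evaluation'']
          have : (PivotalCategory.iso X).hom ⊗≫ (PivotalCategory.iso X).inv = 𝟙 X := by
            simp [monoidalComp]
          calc _ = 𝟙 _ ⊗≫ ((PivotalCategory.iso X).hom ⊗≫ (PivotalCategory.iso X).inv) ⊗≫ 𝟙 _ := by
                monoidal
            _ = _ := by rw [this]; monoidal
  evaluation_coevaluation' := by
    rw [coevBar, evBar]
    calc _ = 𝟙 _ ⊗≫ η_ (Xᘁ : C) (((Xᘁ : C)ᘁ) : C) ▷ (Xᘁ : C) ⊗≫ (Xᘁ : C) ◁ ((PivotalCategory.iso X).inv ≫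
          (PivotalCategory.iso X).hom) ▷ (Xᘁ : C) ⊗≫ (Xᘁ : C) ◁ ε_ (Xᘁ : C) (((Xᘁ : C)ᘁ) : C) ⊗≫ 𝟙 _ := by
            monoidal
      _ = 𝟙 _ ⊗≫ (η_ (Xᘁ : C) (((Xᘁ : C)ᘁ) : C) ▷ (Xᘁ : C) ⊗≫ (Xᘁ : C) ◁ ε_ (Xᘁ : C) (((Xᘁ : C)ᘁ) : C)) ⊗≫ 𝟙 _ := by
          rw [Iso.inv_hom_id]; monoidal
      _ = _ := by rw [evaluation_coevaluation'']; monoidal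

lemma coevBar_evBar (X : C) : X ◁ coevBar X ⊗≫ evBar X ▷ X = ⊗𝟙.hom :=
  @coevaluation_evaluation'' _ _ _ _ _ (barPairing X)

lemma evBar_coevBar (X : C) : coevBar X ▷ Xᘁ ⊗≫ Xᘁ ◁ evBar X = ⊗𝟙.hom :=
  @evaluation_coevaluation'' _ _ _ _ _ (barPairing X)

/-- Transposition of the left tensor factor `x` to a left dual tensor factor. -/
def curry {x W Z : C} (G : x ⊗ W ⟶ Z) : W ⟶ xᘁ ⊗ Z :=
  (λ_ W).inv ≫ coevBar x ▷ W ≫ (α_ _ _ _).hom ≫ xᘁ ◁ G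

/-- Transposition of a dual tensor factor on the left, using the second evaluation. -/
def uncurry {x W Z : C} (G : W ⟶ xᘁ ⊗ Z) : x ⊗ W ⟶ Z :=
  x ◁ G ≫ (α_ _ _ _).inv ≫ evBar x ▷ Z ≫ (λ_ Z).hom

lemma uncurry_curry {x W Z : C} (G : x ⊗ W ⟶ Z) : uncurry (curry G) = G := by
  rw [uncurry, curry]
  calc _ = 𝟙 _ ⊗≫ x ◁ coevBar x ▷ W ⊗≫ ((x ⊗ xᘁ) ◁ G ≫ evBar x ▷ Z) ⊗≫ 𝟙 _ := by monoidal
    _ = 𝟙 _ ⊗≫ (x ◁ coevBar x ⊗≫ evBar x ▷ x) ▷ W ⊗≫ G := by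
      rw [whisker_exchange]; monoidal
    _ = _ := by rw [coevBar_evBar]; monoidal

lemma curry_uncurry {x W Z : C} (G : W ⟶ xᘁ ⊗ Z) : curry (uncurry G) = G := by
  rw [uncurry, curry]
  calc _ = 𝟙 _ ⊗≫ (coevBar x ▷ W ≫ (xᘁ ⊗ x) ◁ G) ⊗≫ xᘁ ◁ evBar x ▷ Z ⊗≫ 𝟙 _ := by monoidal
    _ = G ⊗≫ (coevBar x ▷ xᘁ ⊗≫ xᘁ ◁ evBar x) ▷ Z ⊗≫ 𝟙 _ := by
      rw [← whisker_exchange]; monoidal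
    _ = _ := by rw [evBar_coevBar]; monoidal

lemma uncurry_comp_left {x V W Z : C} (f : V ⟶ W) (G : W ⟶ xᘁ ⊗ Z) :
    uncurry (f ≫ G) = x ◁ f ≫ uncurry G := by
  simp [uncurry]

lemma uncurry_comp_right {x W Z Z' : C} (G : W ⟶ xᘁ ⊗ Z) (k : Z ⟶ Z') :
    uncurry (G ≫ xᘁ ◁ k) = uncurry G ≫ k := by
  simp only [uncurry, MonoidalCategory.whiskerLeft_comp, Category.assoc,
    ← leftUnitor_naturality, ← whisker_exchange_assoc, associator_inv_naturality_right_assoc]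

/-- The morphism `x̄ ⟶ X` that corresponds to an element of `H⟨X x⟩`. -/
def ofPairBar {X x : C} (F : 𝟙_ C ⟶ X ⊗ x) : xᘁ ⟶ X :=
  (λ_ _).inv ≫ F ▷ xᘁ ≫ (α_ _ _ _).hom ≫ X ◁ evBar x ≫ (ρ_ X).hom

lemma circInBar_eq {P X Y : C} (b : C) (f : 𝟙_ C ⟶ X ⊗ b) (g : 𝟙_ C ⟶ P ⊗ (bᘁ ⊗ Y)) :
    circInBar b f g = g ≫ P ◁ (ofPairBar f ▷ Y) := by
  rw [circInBar, ofPairBar]; monoidal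

lemma circBar_eq {X Y : C} (b : C) (f : 𝟙_ C ⟶ X ⊗ b) (g : 𝟙_ C ⟶ bᘁ ⊗ Y) :
    circBar b f g = f ≫ X ◁ ((ρ_ b).inv ≫ uncurry g) := by
  rw [circBar, uncurry, MonoidalCategory.tensorHom_def]; monoidal

lemma rot_toPair {x t : C} (g : t ⟶ x) : rot (toPair g) = coevBar x ≫ (gᘁ : xᘁ ⟶ tᘁ) ▷ x := by
  rw [rot, toPair, rightAdjointMate]; monoidal

lemma ofPairBar_rot {x t : C} (α : 𝟙_ C ⟶ x ⊗ tᘁ) :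
    ofPairBar (rot α) = ((ofPair α)ᘁ : xᘁ ⟶ tᘁ) := by
  conv_lhs => rw [← toPair_ofPair α, rot_toPair]
  generalize ofPair α = g
  rw [ofPairBar]
  calc _ = 𝟙 _ ⊗≫ coevBar x ▷ xᘁ ⊗≫ ((gᘁ : xᘁ ⟶ tᘁ) ▷ (x ⊗ xᘁ) ≫ tᘁ ◁ evBar x) ⊗≫ 𝟙 _ := by
        monoidal
    _ = 𝟙 _ ⊗≫ (coevBar x ▷ xᘁ ⊗≫ xᘁ ◁ evBar x) ⊗≫ (gᘁ : xᘁ ⟶ tᘁ) := by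
        rw [← whisker_exchange]; monoidal
    _ = _ := by rw [evBar_coevBar]; monoidal

lemma uncurry_comp_mate {x t W Z : C} (g : t ⟶ x) (G : W ⟶ xᘁ ⊗ Z) :
    uncurry (G ≫ (gᘁ : xᘁ ⟶ tᘁ) ▷ Z) = g ▷ W ≫ uncurry G := by
  rw [uncurry, uncurry]
  calc _ = t ◁ G ⊗≫ (t ◁ (gᘁ : xᘁ ⟶ tᘁ) ≫ evBar t) ▷ Z ⊗≫ 𝟙 _ := by monoidal
    _ = (t ◁ G ≫ g ▷ (xᘁ ⊗ Z)) ⊗≫ evBar x ▷ Z ⊗≫ 𝟙 _ := by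
        rw [← evBar_naturality]; monoidal
    _ = _ := by rw [whisker_exchange]; monoidal

lemma uncurry_rot {x t : C} (α : 𝟙_ C ⟶ x ⊗ tᘁ) :
    (ρ_ t).inv ≫ uncurry (rot α) = ofPair α := by
  conv_lhs => rw [← toPair_ofPair α, rot_toPair]
  generalize ofPair α = g
  rw [uncurry_comp_mate, uncurry, ← rightUnitor_inv_naturality_assoc]
  calc _ = g ⊗≫ (x ◁ coevBar x ⊗≫ evBar x ▷ x) ⊗≫ 𝟙 _ := by monoidal
    _ = _ := by rw [coevBar_evBar]; monoidal

/-- The object `U ≅ 𝟙` has dimension one. -/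
lemma unitDualIso_evBar {U : C} (e : U ≅ 𝟙_ C) :
    U ◁ (unitDualIso (Y := Uᘁ) e).hom ≫ evBar U = (ρ_ U).hom ≫ e.hom := by
  set u := unitDualIso (Y := Uᘁ) e with hu
  -- The left side is some isomorphism s in place of e; their ratio is the dimension of U. It
  -- remains to show s = e.
  obtain ⟨s, hs⟩ : ∃ s : U ≅ 𝟙_ C, U ◁ u.hom ≫ evBar U = (ρ_ U).hom ≫ s.hom := by
    refine ⟨PivotalCategory.iso U ≪≫
      (unitDualIso (Y := (((Uᘁ : C)ᘁ) : C)) u.symm).symm, ?_⟩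
    change _ = (ρ_ U).hom ≫ (PivotalCategory.iso U).hom ≫
      (ρ_ _).inv ≫ _ ◁ u.hom ≫ ε_ (Uᘁ : C) (((Uᘁ : C)ᘁ) : C)
    rw [evBar, whisker_exchange_assoc]; monoidal
  -- The dimension is multiplicative and U ⊗ U ≅ U by m, so it is idempotent; being invertible, it
  -- is one. Concretely, `h3` evaluates U ⊗ U in two ways, by naturality along m and by
  -- `evBar_tensor`.
  obtain ⟨m, hm⟩ : ∃ m : U ⊗ U ⟶ U, m = e.hom ▷ U ≫ (λ_ U).hom := ⟨_, rfl⟩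
  have h1 := evBar_naturality m
  have h2 : u.hom ≫ (mᘁ : Uᘁ ⟶ (U ⊗ U)ᘁ) =
      (λ_ _).inv ≫ (u.hom ⊗ₘ u.hom) ≫ (rightDualTensorIso U U).inv := by
    apply ext_evaluation
    rw [comp_whiskerRight, Category.assoc, rightAdjointMate_comp_evaluation,
      ← whisker_exchange_assoc, unitDualIso_evaluation, comp_whiskerRight, comp_whiskerRight,
      Category.assoc, Category.assoc, rightDualTensorIso_inv_evaluation,
      MonoidalCategory.tensorHom_def]
    symm
    calc _ = 𝟙 _ ⊗≫ u.hom ▷ (U ⊗ U) ⊗≫ (Uᘁ : C) ◁ (u.hom ▷ U ≫ ε_ U Uᘁ) ▷ U ⊗≫ ε_ U Uᘁ := by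
          monoidal
      _ = 𝟙 _ ⊗≫ (u.hom ▷ (U ⊗ U) ≫ (Uᘁ : C) ◁ (e.hom ▷ U ≫ (λ_ U).hom)) ≫ ε_ U Uᘁ := by
          rw [unitDualIso_evaluation]; monoidal
      _ = 𝟙 _ ⊗≫ (e.hom ▷ U ≫ (λ_ U).hom) ⊗≫ (u.hom ▷ U ≫ ε_ U Uᘁ) := by
          rw [← whisker_exchange]; monoidal
      _ = _ := by rw [unitDualIso_evaluation, hm]; monoidal
  have h3 : (ρ_ _).hom ≫ m ≫ s.hom = (ρ_ _).hom ≫ s.hom ▷ U ≫ (λ_ U).hom ≫ s.hom := by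
    have h4 : (U ⊗ U) ◁ u.hom ≫ m ▷ Uᘁ ≫ evBar U = (ρ_ _).hom ≫ m ≫ s.hom := by
      rw [whisker_exchange_assoc, hs]; simp
    rw [← h4, h1, ← MonoidalCategory.whiskerLeft_comp_assoc, h2,
      MonoidalCategory.whiskerLeft_comp, MonoidalCategory.whiskerLeft_comp, Category.assoc,
      Category.assoc, evBar_tensor, MonoidalCategory.tensorHom_def']
    calc _ = 𝟙 _ ⊗≫ U ◁ (U ◁ u.hom) ⊗≫ (U ⊗ U) ◁ u.hom ▷ Uᘁ ⊗≫ U ◁ evBar U ▷ Uᘁ ⊗≫ evBar U := by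
          monoidal
      _ = 𝟙 _ ⊗≫ U ◁ (U ◁ u.hom) ⊗≫ U ◁ (U ◁ u.hom ≫ evBar U) ▷ Uᘁ ⊗≫ evBar U := by
          monoidal
      _ = 𝟙 _ ⊗≫ U ◁ ((U ⊗ 𝟙_ C) ◁ u.hom ≫ ((ρ_ U).hom ≫ s.hom) ▷ Uᘁ) ⊗≫ evBar U := by
          rw [hs]; monoidal
      _ = 𝟙 _ ⊗≫ U ◁ s.hom ⊗≫ (U ◁ u.hom ≫ evBar U) := by
          rw [whisker_exchange]; monoidal
      _ = 𝟙 _ ⊗≫ (U ◁ s.hom ≫ s.hom ▷ 𝟙_ C) ⊗≫ 𝟙 _ := by rw [hs]; monoidal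
      _ = _ := by rw [whisker_exchange]; monoidal
  rw [hs]
  congr 1
  rw [cancel_epi, ← Category.assoc (s.hom ▷ U), cancel_mono] at h3
  have h5 : e.hom ▷ U = s.hom ▷ U := by simpa [hm] using h3
  have h6 : e.hom ▷ 𝟙_ C = s.hom ▷ 𝟙_ C := by
    rw [← cancel_epi (U ◁ e.hom), whisker_exchange, whisker_exchange, h5]
  simpa using h6.symm

/-- The evaluation `b̄ ⊗ b ⟶ 𝟙` is the second evaluation of `b̄`. -/
lemma evaluation_eq_evBar (b : C) :
    ε_ b bᘁ = bᘁ ◁ (PivotalCategory.iso b).hom ≫ evBar (bᘁ : C) := by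
  -- The unit is replaced by a copy U, whose dual is related to 𝟙 only through `unitDualIso`.
  suffices H : ∀ (U : C) (e : U ≅ 𝟙_ C), ε_ b bᘁ = bᘁ ◁ (PivotalCategory.iso b).hom ≫
      evBar (bᘁ : C) from H (𝟙_ C) (Iso.refl _)
  intro U e
  have hu := unitDualIso_evBar e
  have hu' := unitDualIso_evaluation (Y := Uᘁ) e
  set u := unitDualIso (Y := Uᘁ) e
  -- Naturality of the second evaluation is applied to ε itself, with values in U. By `h2` the mate
  -- of ε is η of b̄; after splitting the second evaluation of b̄ ⊗ b, a zigzag leaves the pivotal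
  -- isomorphism followed by that of b̄.
  obtain ⟨f, hf⟩ : ∃ f : bᘁ ⊗ b ⟶ U, f = ε_ b bᘁ ≫ e.inv := ⟨_, rfl⟩
  have h1 := evBar_naturality f
  have h2 : u.hom ≫ (fᘁ : Uᘁ ⟶ ((bᘁ : C) ⊗ b)ᘁ) =
      η_ (bᘁ : C) (((bᘁ : C)ᘁ) : C) ≫ (rightDualTensorIso (bᘁ : C) b).inv := by
    apply ext_evaluation
    rw [comp_whiskerRight, Category.assoc, rightAdjointMate_comp_evaluation,
      ← whisker_exchange_assoc, hu', comp_whiskerRight, Category.assoc,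
      rightDualTensorIso_inv_evaluation, hf]
    symm
    calc _ = 𝟙 _ ⊗≫ (η_ (bᘁ : C) (((bᘁ : C)ᘁ) : C) ▷ (bᘁ : C) ⊗≫
          (bᘁ : C) ◁ ε_ (bᘁ : C) (((bᘁ : C)ᘁ) : C)) ▷ b ⊗≫ ε_ b bᘁ := by monoidal
      _ = 𝟙 _ ⊗≫ (ε_ b bᘁ ≫ e.inv ≫ e.hom) ⊗≫ 𝟙 _ := by
          rw [evaluation_coevaluation'', e.inv_hom_id]; monoidal
      _ = _ := by monoidal
  have h4 : ((bᘁ : C) ⊗ b) ◁ u.hom ≫ f ▷ Uᘁ ≫ evBar U = (ρ_ _).hom ≫ ε_ b bᘁ := by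
    rw [whisker_exchange_assoc, hu]; simp [hf]
  rw [← cancel_epi (ρ_ ((bᘁ : C) ⊗ b)).hom, ← h4, h1, ← MonoidalCategory.whiskerLeft_comp_assoc,
    h2, MonoidalCategory.whiskerLeft_comp, Category.assoc, evBar_tensor]
  calc _ = 𝟙 _ ⊗≫ (bᘁ : C) ◁ (b ◁ η_ (bᘁ : C) (((bᘁ : C)ᘁ) : C) ⊗≫
        evBar b ▷ (((bᘁ : C)ᘁ) : C)) ⊗≫ evBar (bᘁ : C) := by monoidal
    _ = 𝟙 _ ⊗≫ (bᘁ : C) ◁ ((b ◁ η_ (bᘁ : C) (((bᘁ : C)ᘁ) : C) ≫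
          (PivotalCategory.iso b).hom ▷ ((bᘁ : C) ⊗ (((bᘁ : C)ᘁ) : C))) ⊗≫
          ε_ (bᘁ : C) (((bᘁ : C)ᘁ) : C) ▷ (((bᘁ : C)ᘁ) : C)) ⊗≫ evBar (bᘁ : C) := by
        conv_lhs => rw [evBar]
        monoidal
    _ = 𝟙 _ ⊗≫ (bᘁ : C) ◁ (PivotalCategory.iso b).hom ⊗≫
          (bᘁ : C) ◁ ((((bᘁ : C)ᘁ) : C) ◁ η_ (bᘁ : C) (((bᘁ : C)ᘁ) : C) ⊗≫
          ε_ (bᘁ : C) (((bᘁ : C)ᘁ) : C) ▷ (((bᘁ : C)ᘁ) : C)) ⊗≫ evBar (bᘁ : C) := by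
        rw [whisker_exchange]; monoidal
    _ = _ := by rw [coevaluation_evaluation'']; monoidal

lemma coevBar_dual_iso_inv (b : C) :
    coevBar (bᘁ : C) ≫ (PivotalCategory.iso b).inv ▷ (bᘁ : C) = η_ b bᘁ := by
  rw [← toPair_ofPair (coevBar (bᘁ : C) ≫ (PivotalCategory.iso b).inv ▷ (bᘁ : C))]
  have : ofPair (coevBar (bᘁ : C) ≫ (PivotalCategory.iso b).inv ▷ (bᘁ : C)) = 𝟙 b := by
    rw [ofPair, evaluation_eq_evBar]
    calc _ = 𝟙 _ ⊗≫ coevBar (bᘁ : C) ▷ b ⊗≫ (PivotalCategory.iso b).inv ▷ ((bᘁ : C) ⊗ b) ⊗≫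
          (b ⊗ (bᘁ : C)) ◁ (PivotalCategory.iso b).hom ⊗≫ b ◁ evBar (bᘁ : C) ⊗≫ 𝟙 _ := by
          monoidal
      _ = 𝟙 _ ⊗≫ coevBar (bᘁ : C) ▷ b ⊗≫ ((PivotalCategory.iso b).inv ▷ ((bᘁ : C) ⊗ b) ≫
          b ◁ ((bᘁ : C) ◁ (PivotalCategory.iso b).hom ≫ evBar (bᘁ : C))) ⊗≫ 𝟙 _ := by
          monoidal
      _ = 𝟙 _ ⊗≫ (coevBar (bᘁ : C) ▷ b ≫ ((((bᘁ : C)ᘁ) : C) ⊗ (bᘁ : C)) ◁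
          (PivotalCategory.iso b).hom) ⊗≫ (((bᘁ : C)ᘁ) : C) ◁ evBar (bᘁ : C) ⊗≫
          (PivotalCategory.iso b).inv := by
          rw [← whisker_exchange]; monoidal
      _ = 𝟙 _ ⊗≫ (PivotalCategory.iso b).hom ⊗≫ (coevBar (bᘁ : C) ▷ (((bᘁ : C)ᘁ) : C) ⊗≫
          (((bᘁ : C)ᘁ) : C) ◁ evBar (bᘁ : C)) ⊗≫ (PivotalCategory.iso b).inv := by
          rw [← whisker_exchange]; monoidal
      _ = 𝟙 _ ⊗≫ ((PivotalCategory.iso b).hom ≫ (PivotalCategory.iso b).inv) := by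
          rw [evBar_coevBar]; monoidal
      _ = _ := by rw [Iso.hom_inv_id]; monoidal
  rw [this, toPair]; simp

/-- Rotation by one edge exchanges the two coevaluations; this rests on `evaluation_eq_evBar`. -/
lemma rot_coevBar (b : C) : rot (coevBar b) = η_ b bᘁ := by
  rw [← coevBar_dual_iso_inv, rot]
  conv_lhs => rw [coevBar.eq_def b]
  calc _ = 𝟙 _ ⊗≫ coevBar (bᘁ : C) ⊗≫ ((((bᘁ : C)ᘁ) : C) ◁ η_ (bᘁ : C) (((bᘁ : C)ᘁ) : C) ⊗≫
        ε_ (bᘁ : C) (((bᘁ : C)ᘁ) : C) ▷ (((bᘁ : C)ᘁ) : C)) ▷ (bᘁ : C) ⊗≫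
        (PivotalCategory.iso b).inv ▷ (bᘁ : C) := by
        calc _ = coevBar (bᘁ : C) ⊗≫ ((bᘁ : C)ᘁ : C) ◁ η_ (bᘁ : C) (((bᘁ : C)ᘁ) : C) ▷ (bᘁ : C) ⊗≫
              (((((bᘁ : C)ᘁ) : C) ⊗ (bᘁ : C)) ◁ (PivotalCategory.iso b).inv ≫
              ε_ (bᘁ : C) (((bᘁ : C)ᘁ) : C) ▷ b) ▷ (bᘁ : C) ⊗≫ 𝟙 _ := by monoidal
          _ = _ := by rw [whisker_exchange]; monoidal
    _ = _ := by rw [coevaluation_evaluation'']; monoidal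

/-! ### Tube elements as morphisms x ⊗ c ⟶ a ⊗ x -/

/-- The morphism `b ⟶ Y` that corresponds to an element of `H⟨b̄ Y⟩`. -/
def ofBar {b Y : C} (f : 𝟙_ C ⟶ bᘁ ⊗ Y) : b ⟶ Y := (ρ_ b).inv ≫ uncurry f

lemma coevBar_ofBar {b Y : C} (f : 𝟙_ C ⟶ bᘁ ⊗ Y) : coevBar b ≫ bᘁ ◁ ofBar f = f := by
  conv_rhs => rw [← curry_uncurry f]
  rw [ofBar, curry]; monoidal

/-- Rotating and then using the first evaluation is the same as using the second evaluation
directly. By `coevBar_ofBar` it suffices to rotate the second coevaluation. -/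
lemma ofPair_rot {b Y : C} (f : 𝟙_ C ⟶ bᘁ ⊗ Y) : ofPair (rot f) = ofBar f := by
  have h : rot f = toPair (ofBar f) := by
    rw [toPair, ← rot_coevBar]
    conv_lhs => rw [← coevBar_ofBar f]
    generalize ofBar f = h
    rw [rot, rot]
    calc _ = coevBar (bᘁ : C) ⊗≫ ((bᘁ : C)ᘁ : C) ◁ coevBar b ▷ (bᘁ : C) ⊗≫
          ((((bᘁ : C)ᘁ) : C) ⊗ (bᘁ : C)) ◁ h ▷ (bᘁ : C) ⊗≫
          ε_ (bᘁ : C) (((bᘁ : C)ᘁ) : C) ▷ (Y ⊗ (bᘁ : C)) ⊗≫ 𝟙 _ := by monoidal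
      _ = coevBar (bᘁ : C) ⊗≫ ((bᘁ : C)ᘁ : C) ◁ coevBar b ▷ (bᘁ : C) ⊗≫
          (((((bᘁ : C)ᘁ) : C) ⊗ (bᘁ : C)) ◁ h ≫
          ε_ (bᘁ : C) (((bᘁ : C)ᘁ) : C) ▷ Y) ▷ (bᘁ : C) ⊗≫ 𝟙 _ := by monoidal
      _ = _ := by rw [whisker_exchange]; monoidal
  rw [h, ofPair_toPair]

/-- The morphism `x ⊗ c ⟶ a ⊗ x` that corresponds to an element of `H⟨c̄ x̄ a x⟩`. -/
def untube {a c x : C} (F : TubeHom a c x) : x ⊗ c ⟶ a ⊗ x := uncurry (ofBar F)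

lemma untube_injective {a c x : C} :
    Function.Injective (untube : TubeHom a c x → (x ⊗ c ⟶ a ⊗ x)) := by
  intro F G h
  have := congrArg curry h
  rw [untube, untube, curry_uncurry, curry_uncurry] at this
  rw [← coevBar_ofBar F, this, coevBar_ofBar]

lemma ofBar_comp {b Y Z : C} (f : 𝟙_ C ⟶ bᘁ ⊗ Y) (k : Y ⟶ Z) :
    ofBar (f ≫ bᘁ ◁ k) = ofBar f ≫ k := by
  rw [ofBar, ofBar, uncurry_comp_right, Category.assoc]

lemma sandwich_eq {a c x t : C} (α : 𝟙_ C ⟶ x ⊗ tᘁ) (β : 𝟙_ C ⟶ t ⊗ xᘁ) (F : TubeHom a c x) :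
    sandwich α β F =
      F ≫ cᘁ ◁ (((ofPair α)ᘁ : xᘁ ⟶ tᘁ) ▷ (a ⊗ x)) ≫ cᘁ ◁ tᘁ ◁ a ◁ ofPair β := by
  rw [sandwich, circBar_eq, circInBar_eq, ofPairBar_rot, uncurry_rot]
  monoidal

/-- Gluing α to the edge x̄ acts by the mate of its transpose, and bending x̄ to the source turns
the mate back into the transpose itself. -/
lemma untube_sandwich {a c x t : C} (α : 𝟙_ C ⟶ x ⊗ tᘁ) (β : 𝟙_ C ⟶ t ⊗ xᘁ)
    (F : TubeHom a c x) :
    untube (sandwich α β F) = ofPair α ▷ c ≫ untube F ≫ a ◁ ofPair β := by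
  rw [sandwich_eq, untube, ← Category.assoc, ofBar_comp, ofBar_comp, uncurry_comp_right,
    uncurry_comp_mate, untube, Category.assoc]

lemma uncurry_tensor {x y W Z : C} (H : W ⟶ yᘁ ⊗ (xᘁ ⊗ Z)) :
    uncurry (H ≫ (α_ yᘁ xᘁ Z).inv ≫ (rightDualTensorIso x y).inv ▷ Z) =
      (α_ x y W).hom ≫ uncurry (uncurry H) := by
  rw [uncurry, uncurry, uncurry]
  calc _ = (x ⊗ y) ◁ H ⊗≫ ((x ⊗ y) ◁ (rightDualTensorIso x y).inv ≫ evBar (x ⊗ y)) ▷ Z ⊗≫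
        𝟙 _ := by monoidal
    _ = _ := by rw [evBar_tensor]; monoidal

lemma glueTube_eq {a b c x y : C} (f : TubeHom a b x) (g : TubeHom b c y) :
    glueTube f g = g ≫ cᘁ ◁ (yᘁ ◁ (ofBar f ▷ y ≫ (α_ _ _ _).hom ≫ xᘁ ◁ (α_ _ _ _).hom) ≫
      (α_ yᘁ xᘁ _).inv ≫ (rightDualTensorIso x y).inv ▷ _) := by
  rw [glueTube, circIn_eq, ofPair_rot]
  monoidal

/-- Bending the dual of x ⊗ y is bending ȳ and then x̄ (`uncurry_tensor`), so the glued tube is a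
stack of two crossings. -/
lemma untube_glueTube {a b c x y : C} (f : TubeHom a b x) (g : TubeHom b c y) :
    untube (glueTube f g) = (α_ x y c).hom ≫ x ◁ untube g ≫ (α_ x b y).inv ≫
      untube f ▷ y ≫ (α_ a x y).hom := by
  rw [glueTube_eq, untube, ofBar_comp, ← Category.assoc (ofBar g), uncurry_tensor,
    uncurry_comp_right, uncurry_comp_left, untube, untube]
  simp only [uncurry]
  monoidal

lemma ofBar_coevBar_comp {b Y : C} (h : b ⟶ Y) : ofBar (coevBar b ≫ bᘁ ◁ h) = h := by
  rw [ofBar_comp]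
  have : ofBar (coevBar b) = 𝟙 b := by
    rw [ofBar, uncurry]
    calc _ = 𝟙 _ ⊗≫ (b ◁ coevBar b ⊗≫ evBar b ▷ b) ⊗≫ 𝟙 _ := by monoidal
      _ = _ := by rw [coevBar_evBar]; monoidal
  rw [this, Category.id_comp]

/-- The element of `H⟨c̄ x̄ a x⟩` that corresponds to a morphism `x ⊗ c ⟶ a ⊗ x`. -/
def tube {a c x : C} (F : x ⊗ c ⟶ a ⊗ x) : TubeHom a c x := coevBar c ≫ cᘁ ◁ curry F

lemma untube_tube {a c x : C} (F : x ⊗ c ⟶ a ⊗ x) : untube (tube F) = F := by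
  rw [untube, tube, ofBar_coevBar_comp, uncurry_curry]

end Duality

/-! ### The unit tube as a morphism -/

section UnitHom

variable {C : Type u} [Category.{v} C] [Abelian C] [MonoidalCategory C]
variable [RightRigidCategory C] [PivotalCategory C]

lemma untube_unitHom (a : C) {i : Gam C} {u : C} (φ : unitObj i ≅ u) :
    untube (unitHom a φ) = (φ.inv ≫ unitIncl i) ▷ a ≫ (λ_ a).hom ≫ (ρ_ a).inv ≫
      a ◁ (unitProj i ≫ φ.hom) := by
  rw [← untube_tube ((φ.inv ≫ unitIncl i) ▷ a ≫ (λ_ a).hom ≫ (ρ_ a).inv ≫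
      a ◁ (unitProj i ≫ φ.hom)), unitHom, tube, curry]
  congr 1
  monoidal

end UnitHom

/-! ### Cyclicity of the right trace -/

section Trace

variable {C : Type u} [Category.{v} C] [MonoidalCategory C] [RightRigidCategory C]
  [PivotalCategory C]

/-- The morphism g slides around the loop as its mate, through the evaluation and back through the
coevaluation. -/
lemma trR_comp_comm {X Y : C} (f : X ⟶ Y) (g : Y ⟶ X) : trR (f ≫ g) = trR (g ≫ f) := by
  simp only [trR, comp_whiskerRight, Category.assoc]
  rw [evBar_naturality g, ← whisker_exchange_assoc, ← Category.assoc,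
    coevaluation_comp_rightAdjointMate, Category.assoc]

lemma trR_of_iso_unit {U : C} (e : U ≅ 𝟙_ C) (h : U ⟶ U) : trR h = e.inv ≫ h ≫ e.hom := by
  have h1 := unitDualIso_evBar e
  have h2 : (unitDualIso (Y := Uᘁ) e).hom = η_ U Uᘁ ≫ e.hom ▷ Uᘁ ≫ (λ_ _).hom := rfl
  set u := unitDualIso (Y := Uᘁ) e
  have h3 : evBar U = U ◁ u.inv ≫ (ρ_ U).hom ≫ e.hom := by
    rw [← h1, ← MonoidalCategory.whiskerLeft_comp_assoc, u.inv_hom_id]; simp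
  have h4 : η_ U Uᘁ = u.hom ≫ (λ_ _).inv ≫ e.inv ▷ Uᘁ := by
    rw [h2]; simp [← comp_whiskerRight]
  rw [trR, h3, h4]
  calc _ = 𝟙 _ ⊗≫ u.hom ⊗≫ ((e.inv ≫ h) ▷ Uᘁ ≫ U ◁ u.inv) ⊗≫ e.hom := by monoidal
    _ = 𝟙 _ ⊗≫ (u.hom ≫ u.inv) ⊗≫ e.inv ⊗≫ h ⊗≫ e.hom := by
      rw [← whisker_exchange]; monoidal
    _ = _ := by rw [u.hom_inv_id]; monoidal

/-- After transposition the pairing of the statement is the trace of a composite t ⟶ x ⟶ t. -/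
lemma circ_comp_evBar {x t : C} (α : 𝟙_ C ⟶ x ⊗ tᘁ) (β : 𝟙_ C ⟶ t ⊗ xᘁ) :
    circ x β α ≫ evBar t = trR (ofPair α ≫ ofPair β) := by
  conv_lhs => rw [circ_eq, ← toPair_ofPair α]
  simp [trR, toPair]

end Trace

/-! ### Components of the category and primitive idempotents -/

section Homogeneous

lemma idem_eq_id_of_simple {C : Type u} [Category.{v} C] [Abelian C] {X : C} [Simple X]
    {f : X ⟶ X} (hf : f ≫ f = f) (h0 : f ≠ 0) :
    f = 𝟙 X := by
  have := isIso_of_hom_simple h0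
  rw [← cancel_mono f, hf, Category.id_comp]

variable {C : Type u} [Category.{v} C] [Abelian C] [MonoidalCategory C]

lemma end_unit_comm {C : Type u} [Category.{v} C] [MonoidalCategory C]
    (f g : 𝟙_ C ⟶ 𝟙_ C) : f ≫ g = g ≫ f := by
  have h := whisker_exchange f g
  rw [id_whiskerLeft, whiskerRight_id] at h
  simpa [unitors_equal, unitors_inv_equal] using h.symm

/-- The product lies below both primitive idempotents, so if it were nonzero it would equal both of
them. -/
lemma Gam.comp_eq_zero {i i' : Gam C} (h : i ≠ i') : i.1 ≫ i'.1 = 0 := by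
  have hi := i.2.1
  have hi' := i'.2.1
  have hc := end_unit_comm i.1 i'.1
  have h1 := i.2.2.2 (i.1 ≫ i'.1)
    (by rw [Category.assoc, ← Category.assoc i'.1, ← hc, Category.assoc, hi', reassoc_of% hi])
    (by rw [Category.assoc, ← hc, reassoc_of% hi]) (by rw [reassoc_of% hi])
  have h2 := i'.2.2.2 (i.1 ≫ i'.1)
    (by rw [Category.assoc, ← Category.assoc i'.1, ← hc, Category.assoc, hi', reassoc_of% hi])
    (by rw [Category.assoc, hi']) (by rw [← Category.assoc, ← hc, Category.assoc, hi'])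
  rcases h1 with h1 | h1
  · exact h1
  · rcases h2 with h2 | h2
    · exact h2
    · exact absurd (Subtype.ext (h1.symm.trans h2)) h

lemma Gam.whiskerRight_unitObj (i : Gam C) : i.1 ▷ unitObj i = 𝟙 _ := by
  have h1 : unitIncl i ≫ i.1 = unitIncl i := by
    rw [← unitProj_incl, ← Category.assoc, unitIncl_proj, Category.id_comp]
  have h : i.1 ▷ unitObj i ≫ 𝟙_ C ◁ unitIncl i = 𝟙 _ ≫ 𝟙_ C ◁ unitIncl i := by
    rw [← whisker_exchange, Category.id_comp, whiskerRight_id, id_whiskerLeft, ← unitors_equal,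
      ← unitors_inv_equal]
    simp only [Category.assoc, Iso.inv_hom_id_assoc]
    rw [← Category.assoc (unitIncl i), h1]
  have : Mono (𝟙_ C ◁ unitIncl i) := by
    rw [id_whiskerLeft]
    infer_instance
  exact (cancel_mono _).1 h

lemma Gam.whiskerLeft_unitObj (i : Gam C) : unitObj i ◁ i.1 = 𝟙 _ := by
  have h := unitObj_action i
  rw [Iso.inv_comp_eq, Category.comp_id] at h
  exact (cancel_mono (ρ_ _).hom).1 (h.trans (Category.id_comp _).symm)

/-- Together with the next two lemmas: X lies in the component ij exactly when the idempotents i and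
j act on it as the identity. -/
lemma Homogeneous.whiskerRight_eq {i j : Gam C} {X : C} (h : Homogeneous i j X) :
    i.1 ▷ X = 𝟙 _ := by
  obtain ⟨e⟩ := h
  rw [← cancel_mono (𝟙_ C ◁ e.hom), ← whisker_exchange, whiskerRight_tensor,
    Gam.whiskerRight_unitObj]
  simp

lemma Homogeneous.whiskerLeft_eq {i j : Gam C} {X : C} (h : Homogeneous i j X) :
    X ◁ j.1 = 𝟙 _ := by
  obtain ⟨e⟩ := h
  rw [← cancel_mono (e.hom ▷ 𝟙_ C), whisker_exchange, tensor_whiskerLeft, tensor_whiskerLeft,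
    Gam.whiskerLeft_unitObj]
  simp

lemma homogeneous_of_whisker_eq {i j : Gam C} {X : C} (hi : i.1 ▷ X = 𝟙 _) (hj : X ◁ j.1 = 𝟙 _) :
    Homogeneous i j X := by
  let A : X ≅ X ⊗ unitObj j :=
    { hom := (ρ_ X).inv ≫ X ◁ unitProj j
      inv := X ◁ unitIncl j ≫ (ρ_ X).hom
      hom_inv_id := by
        rw [Category.assoc, ← MonoidalCategory.whiskerLeft_comp_assoc, unitProj_incl, hj]; simp
      inv_hom_id := by
        simp [← MonoidalCategory.whiskerLeft_comp] }
  have hi' : i.1 ▷ (X ⊗ unitObj j) = 𝟙 _ := by rw [whiskerRight_tensor, hi]; simp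
  let B : X ⊗ unitObj j ≅ unitObj i ⊗ (X ⊗ unitObj j) :=
    { hom := (λ_ _).inv ≫ unitProj i ▷ _
      inv := unitIncl i ▷ _ ≫ (λ_ _).hom
      hom_inv_id := by
        rw [Category.assoc, ← comp_whiskerRight_assoc, unitProj_incl, hi']; simp
      inv_hom_id := by
        rw [Category.assoc, Iso.hom_inv_id_assoc, ← comp_whiskerRight, unitIncl_proj]; simp }
  exact ⟨A ≪≫ B⟩

lemma id_eq_zero_of_unit_tensor {X : C} (h : 𝟙 (𝟙_ C ⊗ X) = 0) : 𝟙 X = 0 := by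
  rw [← (λ_ X).inv_hom_id, ← Category.id_comp (λ_ X).hom, h]; simp

lemma id_eq_zero_of_tensor_unit {X : C} (h : 𝟙 (X ⊗ 𝟙_ C) = 0) : 𝟙 X = 0 := by
  rw [← (ρ_ X).inv_hom_id, ← Category.id_comp (ρ_ X).hom, h]; simp

variable (C) in
/-- The unit object is a finite direct sum of the components of primitive idempotents. -/
lemma exists_sum_gam [SemisimpleCategory C] :
    ∃ (n : ℕ) (e : Fin n → Gam C), ∑ m, (e m).1 = 𝟙 (𝟙_ C) := by
  obtain ⟨n, S, hS, ⟨φ⟩⟩ := SemisimpleCategory.exists_simples (𝟙_ C)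
  have hm : ∀ m, (biproduct.ι S m ≫ φ.inv) ≫ (φ.hom ≫ biproduct.π S m) = 𝟙 _ := by
    intro m; simp
  -- The idempotents project onto the simple summands of 𝟙. A smaller idempotent restricts to an
  -- idempotent endomorphism of a simple object, which is zero or the identity.
  refine ⟨n, fun m => ⟨(φ.hom ≫ biproduct.π S m) ≫ biproduct.ι S m ≫ φ.inv, ?_, ?_, ?_⟩, ?_⟩
  · have h := hm m
    generalize φ.hom ≫ biproduct.π S m = p, biproduct.ι S m ≫ φ.inv = q at *
    rw [Category.assoc, reassoc_of% h]
  · intro h0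
    have := hS m
    apply id_nonzero (S m)
    have h1 := congrArg (fun f => (biproduct.ι S m ≫ φ.inv) ≫ f ≫ (φ.hom ≫ biproduct.π S m)) h0
    simpa using h1
  · intro f hf h1 h2
    have := hS m
    generalize φ.hom ≫ biproduct.π S m = p, biproduct.ι S m ≫ φ.inv = q at *
    have hqp := hm m
    have hg : (q ≫ f ≫ p) ≫ (q ≫ f ≫ p) = q ≫ f ≫ p := by
      simp only [Category.assoc] at h1 ⊢
      rw [reassoc_of% h1, reassoc_of% hf]
    have hf' : f = p ≫ (q ≫ f ≫ p) ≫ q := by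
      simp only [Category.assoc] at h1 h2 ⊢
      rw [h1, h2]
    by_cases h0 : q ≫ f ≫ p = 0
    · left; rw [hf', h0]; simp
    · right; rw [hf', idem_eq_id_of_simple hg h0]; simp
  · have h := congrArg (fun f => φ.hom ≫ f ≫ φ.inv) (biproduct.total (f := S))
    simp only [Preadditive.sum_comp, Preadditive.comp_sum, Category.assoc, Category.id_comp,
      Iso.hom_inv_id] at h ⊢
    exact h

variable [MonoidalPreadditive C]

lemma Homogeneous.left_unique {i j i' j' : Gam C} {X : C} (h : Homogeneous i j X)
    (h' : Homogeneous i' j' X) (hX : 𝟙 X ≠ 0) : i = i' := by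
  by_contra hne
  apply hX
  apply id_eq_zero_of_unit_tensor
  have := congrArg (fun f => f ▷ X) (Gam.comp_eq_zero hne)
  simpa [h.whiskerRight_eq, h'.whiskerRight_eq] using this

lemma Homogeneous.right_unique {i j i' j' : Gam C} {X : C} (h : Homogeneous i j X)
    (h' : Homogeneous i' j' X) (hX : 𝟙 X ≠ 0) : j = j' := by
  by_contra hne
  apply hX
  apply id_eq_zero_of_tensor_unit
  have := congrArg (fun f => X ◁ f) (Gam.comp_eq_zero hne)
  simpa [h.whiskerLeft_eq, h'.whiskerLeft_eq] using this

/-- The tensor product of objects of components that do not match is zero. -/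
lemma Homogeneous.tensor_id_eq_zero {i j i' j' : Gam C} {X Y : C} (h : Homogeneous i j X)
    (h' : Homogeneous i' j' Y) (hne : j ≠ i') : 𝟙 (X ⊗ Y) = 0 := by
  have h1 : X ◁ (j.1 ▷ Y) ≫ X ◁ (i'.1 ▷ Y) = 0 := by
    rw [← MonoidalCategory.whiskerLeft_comp, ← comp_whiskerRight, Gam.comp_eq_zero hne]; simp
  have h2 : X ◁ (j.1 ▷ Y) = 𝟙 _ := by
    have := whisker_assoc_symm X j.1 Y
    rw [h.whiskerLeft_eq] at this
    rw [this]; simp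
  rw [h2, h'.whiskerRight_eq] at h1
  have h3 : 𝟙 (X ⊗ (𝟙_ C ⊗ Y)) = 0 := by simpa using h1
  have h4 : X ◁ (λ_ Y).inv ≫ 𝟙 (X ⊗ (𝟙_ C ⊗ Y)) ≫ X ◁ (λ_ Y).hom = 𝟙 (X ⊗ Y) := by
    rw [Category.id_comp, ← MonoidalCategory.whiskerLeft_comp]; simp
  rw [← h4, h3]; simp

lemma Homogeneous.hom_tensor_eq_zero {i j i' j' : Gam C} {X Y Z : C} (h : Homogeneous i j X)
    (h' : Homogeneous i' j' Y) (hne : j ≠ i') (f : Z ⟶ X ⊗ Y) : f = 0 := by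
  rw [← Category.comp_id f, h.tensor_id_eq_zero h' hne, comp_zero]

lemma Homogeneous.tensor_hom_eq_zero {i j i' j' : Gam C} {X Y Z : C} (h : Homogeneous i j X)
    (h' : Homogeneous i' j' Y) (hne : j ≠ i') (f : X ⊗ Y ⟶ Z) : f = 0 := by
  rw [← Category.id_comp f, h.tensor_id_eq_zero h' hne, zero_comp]

/-- Primitive idempotents sum to the identity of 𝟙, so on each side one acts on X by a nonzero map.
That map is an idempotent of a simple object, hence the identity. -/
lemma exists_homogeneous [SemisimpleCategory C] (X : C) [Simple X] :
    ∃ i j : Gam C, Homogeneous i j X := by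
  obtain ⟨n, e, he⟩ := exists_sum_gam C
  have hl : ∃ m, (e m).1 ▷ X ≠ 0 := by
    by_contra! hcon
    apply id_nonzero X
    apply id_eq_zero_of_unit_tensor
    rw [← id_whiskerRight, ← he, sum_whiskerRight]
    exact Finset.sum_eq_zero fun m _ => hcon m
  have hr : ∃ m, X ◁ (e m).1 ≠ 0 := by
    by_contra! hcon
    apply id_nonzero X
    apply id_eq_zero_of_tensor_unit
    rw [← MonoidalCategory.whiskerLeft_id, ← he, whiskerLeft_sum]
    exact Finset.sum_eq_zero fun m _ => hcon m
  obtain ⟨m, hm⟩ := hl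
  obtain ⟨m', hm'⟩ := hr
  have : Simple (𝟙_ C ⊗ X) := Simple.of_iso (λ_ X)
  have : Simple (X ⊗ 𝟙_ C) := Simple.of_iso (ρ_ X)
  refine ⟨e m, e m', homogeneous_of_whisker_eq (idem_eq_id_of_simple ?_ hm)
    (idem_eq_id_of_simple ?_ hm')⟩
  · rw [← comp_whiskerRight, (e m).2.1]
  · rw [← MonoidalCategory.whiskerLeft_comp, (e m').2.1]

end Homogeneous

/-! ### Simple labels -/

section Labels

variable {C : Type u} [Category.{v} C] [Abelian C] [MonoidalCategory C] [MonoidalPreadditive C]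

instance (S : SimpleReps C) (t : Label S.carrier) : Simple t.obj := S.simple t.2.2.2

/-- A nonzero object determines its component, so isomorphic labels share their indices; uniqueness
of representatives does the rest. -/
lemma SimpleReps.label_ext (S : SimpleReps C) {s t : Label S.carrier}
    (h : Nonempty (s.obj ≅ t.obj)) : s = t := by
  obtain ⟨i, j, X, hX⟩ := s
  obtain ⟨i', j', Y, hY⟩ := t
  obtain ⟨φ⟩ := h
  change X ≅ Y at φ
  have hX1 := S.homogeneous hX
  have hX2 : Homogeneous i' j' X := by
    obtain ⟨ψ⟩ := S.homogeneous hY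
    exact ⟨φ ≪≫ ψ ≪≫ whiskerLeftIso _ (whiskerRightIso φ.symm _)⟩
  have : Simple X := S.simple hX
  obtain rfl := hX1.left_unique hX2 (id_nonzero X)
  obtain rfl := hX1.right_unique hX2 (id_nonzero X)
  obtain rfl := (S.exists_unique i j X inferInstance hX1).unique ⟨hX, ⟨Iso.refl _⟩⟩ ⟨hY, ⟨φ⟩⟩
  rfl

lemma SimpleReps.exists_label [SemisimpleCategory C] (S : SimpleReps C) (X : C) [Simple X] :
    ∃ t : Label S.carrier, Nonempty (X ≅ t.obj) := by
  obtain ⟨i, j, h⟩ := exists_homogeneous X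
  obtain ⟨Y, ⟨hY, e⟩, -⟩ := S.exists_unique i j X inferInstance h
  exact ⟨⟨i, j, Y, hY⟩, e⟩

lemma SimpleReps.hom_eq_zero (S : SimpleReps C) {s t : Label S.carrier} (h : s ≠ t)
    (f : s.obj ⟶ t.obj) : f = 0 := by
  by_contra h0
  have := isIso_of_hom_simple h0
  exact h (S.label_ext ⟨asIso f⟩)

end Labels

/-! ### Splitting and finite support in the semisimple category -/

section Semisimple

variable {C : Type u} [Category.{v} C] [Abelian C] [SemisimpleCategory C]

/-- Some component of α in a simple summand is nonzero, hence an isomorphism by Schur's lemma. -/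
lemma exists_comp_eq_id {t X : C} [Simple t] {α : t ⟶ X} (h : α ≠ 0) :
    ∃ β : X ⟶ t, α ≫ β = 𝟙 t := by
  obtain ⟨n, S, hS, ⟨φ⟩⟩ := SemisimpleCategory.exists_simples X
  have hex : ∃ m, α ≫ φ.hom ≫ biproduct.π S m ≠ 0 := by
    by_contra! hcon
    apply h
    rw [← cancel_mono φ.hom, zero_comp]
    exact biproduct.hom_ext _ _ fun m => by simpa using hcon m
  obtain ⟨m, hm⟩ := hex
  have := hS m
  have := isIso_of_hom_simple hm
  exact ⟨φ.hom ≫ biproduct.π S m ≫ inv (α ≫ φ.hom ≫ biproduct.π S m), by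
    simpa only [Category.assoc] using IsIso.hom_inv_id (α ≫ φ.hom ≫ biproduct.π S m)⟩

lemma exists_comp_eq_id' {t X : C} [Simple t] {β : X ⟶ t} (h : β ≠ 0) :
    ∃ α : t ⟶ X, α ≫ β = 𝟙 t := by
  obtain ⟨n, S, hS, ⟨φ⟩⟩ := SemisimpleCategory.exists_simples X
  have hex : ∃ m, biproduct.ι S m ≫ φ.inv ≫ β ≠ 0 := by
    by_contra! hcon
    apply h
    rw [← cancel_epi φ.inv, comp_zero]
    exact biproduct.hom_ext' _ _ fun m => by simpa using hcon m
  obtain ⟨m, hm⟩ := hex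
  have := hS m
  have := isIso_of_hom_simple hm
  exact ⟨inv (biproduct.ι S m ≫ φ.inv ≫ β) ≫ biproduct.ι S m ≫ φ.inv, by
    simpa only [Category.assoc] using IsIso.inv_hom_id (biproduct.ι S m ≫ φ.inv ≫ β)⟩

variable [MonoidalCategory C] [MonoidalPreadditive C]

lemma SimpleReps.hom_ext (S : SimpleReps C) {X Y : C} {f g : X ⟶ Y}
    (h : ∀ (s : Label S.carrier) (φ : s.obj ⟶ X), φ ≫ f = φ ≫ g) : f = g := by
  obtain ⟨n, T, hT, ⟨φ⟩⟩ := SemisimpleCategory.exists_simples X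
  rw [← cancel_epi φ.inv]
  refine biproduct.hom_ext' _ _ fun m => ?_
  have := hT m
  obtain ⟨s, ⟨e⟩⟩ := S.exists_label (T m)
  rw [← cancel_epi e.inv]
  simpa using h s (e.inv ≫ biproduct.ι T m ≫ φ.inv)

lemma SimpleReps.finite_support (S : SimpleReps C) (X : C) :
    {t : Label S.carrier | ∃ f : t.obj ⟶ X, f ≠ 0}.Finite := by
  obtain ⟨n, T, hT, ⟨φ⟩⟩ := SemisimpleCategory.exists_simples X
  choose s e using fun m => have := hT m; S.exists_label (T m)
  refine (Set.finite_range s).subset ?_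
  rintro t ⟨f, hf⟩
  obtain ⟨β, hβ⟩ := exists_comp_eq_id hf
  by_contra hcon
  apply hf
  rw [← cancel_mono φ.hom, zero_comp]
  refine biproduct.hom_ext _ _ fun m => ?_
  rw [← cancel_mono (e m).some.hom, S.hom_eq_zero (s := t) (t := s m)
    (fun h => hcon ⟨m, h.symm⟩) (((f ≫ φ.hom) ≫ biproduct.π T m) ≫ (e m).some.hom)]
  simp

/-- The finite set of simple labels that occur in `X`. -/
def SimpleReps.support (S : SimpleReps C) (X : C) : Finset (Label S.carrier) :=
  (S.finite_support X).toFinset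

lemma SimpleReps.hom_eq_zero_of_notMem (S : SimpleReps C) {X : C} {t : Label S.carrier}
    (h : t ∉ S.support X) (f : t.obj ⟶ X) : f = 0 := by
  by_contra h0
  exact h ((Set.Finite.mem_toFinset _).2 ⟨f, h0⟩)

end Semisimple

/-! ### Scalars and the dimension of the unit components -/

section Scalars

variable (k : Type w) [Field k] [IsAlgClosed k]
variable {C : Type u} [Category.{v} C] [Abelian C] [Linear k C] [LocallyFiniteCategory k C]

lemma exists_smul_id {t : C} [Simple t] (f : t ⟶ t) : ∃ c : k, c • 𝟙 t = f := by
  have := LocallyFiniteCategory.finite_hom (k := k) t t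
  exact endomorphism_simple_eq_smul_id k f

variable [MonoidalCategory C] [SemisimpleCategory C]

lemma endUnitEquiv_id (i : Gam C) : endUnitEquiv k i (𝟙 (unitObj i)) = 1 := by
  rw [endUnitEquiv, LinearEquiv.symm_apply_eq]
  simp

variable [RightRigidCategory C] [PivotalCategory C]

/-- The identity of u factors through 𝟙, so by cyclicity its trace is that of the idempotent i on 𝟙,
which is i itself. -/
lemma dimAt_of_iso_unitObj (i : Gam C) {u : C} (φ : unitObj i ≅ u) : dimAt k i u = 1 := by
  have h := trR_comp_comm (φ.inv ≫ unitIncl i) (unitProj i ≫ φ.hom)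
  rw [dimAt]
  have h1 : (φ.inv ≫ unitIncl i) ≫ (unitProj i ≫ φ.hom) = 𝟙 u := by
    rw [Category.assoc, ← Category.assoc (unitIncl i), unitIncl_proj]; simp
  rw [h1, trR_of_iso_unit (Iso.refl _)] at h
  rw [h, scalarAt, ← endUnitEquiv_id k i]
  congr 1
  have h2 : (unitProj i ≫ φ.hom) ≫ φ.inv ≫ unitIncl i = unitProj i ≫ unitIncl i := by
    rw [Category.assoc, φ.hom_inv_id_assoc]
  rw [h2, Iso.refl_inv, Iso.refl_hom, Category.id_comp, Category.comp_id, Category.assoc,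
    unitIncl_proj, Category.comp_id, unitIncl_proj]

end Scalars

/-! ### The trace pairing, dual bases and resolving families -/

section Linear

variable (k : Type w) [Field k] [IsAlgClosed k]
variable {C : Type u} [Category.{v} C] [Abelian C] [Linear k C] [MonoidalCategory C]
  [MonoidalPreadditive C] [MonoidalLinear k C] [RightRigidCategory C]
  [LocallyFiniteCategory k C] [SemisimpleCategory C] [PivotalCategory C]

/-- The right trace as a linear form. -/
def trLin (i : Gam C) (X : C) : (X ⟶ X) →ₗ[k] k where
  toFun f := scalarAt k i (trR f)
  map_add' f g := by simp [scalarAt, trR]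
  map_smul' r f := by simp [scalarAt, trR]

lemma pairing_eq_trLin (i : Gam C) {x t : C} (β : 𝟙_ C ⟶ t ⊗ xᘁ) (α : 𝟙_ C ⟶ x ⊗ tᘁ) :
    pairing k i β α = trLin k i t (ofPair α ≫ ofPair β) :=
  congrArg (scalarAt k i) (circ_comp_evBar α β)

/-- The second evaluation, projected to 𝟙_i, is nonzero by the zigzag identity, so it has a section.
The space Hom(𝟙, t ⊗ t̄) ≅ End(t) consists of the multiples of η, so the section comes from some c •
η, which forces c · d_t = 1. -/
lemma dimAt_ne_zero {i j : Gam C} {t : C} [Simple t] (ht : Homogeneous i j t) :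
    dimAt k i t ≠ 0 := by
  have hw : evBar t ≫ unitProj i ≠ 0 := by
    intro h0
    apply id_nonzero t
    have h1 : evBar t ≫ i.1 = 0 := by rw [← unitProj_incl, reassoc_of% h0, zero_comp]
    calc 𝟙 t = 𝟙 _ ⊗≫ (t ◁ coevBar t ⊗≫ evBar t ▷ t) ⊗≫ 𝟙 _ := by
          rw [coevBar_evBar]; monoidal
      _ = 𝟙 _ ⊗≫ t ◁ coevBar t ⊗≫ (evBar t ▷ t ≫ i.1 ▷ t) ⊗≫ 𝟙 _ := by
          rw [ht.whiskerRight_eq]; monoidal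
      _ = 0 := by
          rw [← comp_whiskerRight, h1]; simp [monoidalComp]
  obtain ⟨h, hh⟩ := exists_comp_eq_id' hw
  obtain ⟨c, hc⟩ := exists_smul_id k (ofPair (unitProj i ≫ h))
  have h2 : unitProj i ≫ h = c • η_ t tᘁ := by
    rw [← toPair_ofPair (unitProj i ≫ h), ← hc, toPair]; simp
  have h3 : c • (unitIncl i ≫ (η_ t tᘁ ≫ evBar t) ≫ unitProj i) = 𝟙 _ := by
    have h3' : unitIncl i ≫ (unitProj i ≫ h) ≫ evBar t ≫ unitProj i = 𝟙 _ := by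
      rw [Category.assoc, hh, Category.comp_id, unitIncl_proj]
    rw [← h3', h2]
    simp
  intro h0
  have h4 := congrArg (endUnitEquiv k i) h3
  rw [map_smul, endUnitEquiv_id] at h4
  have h5 : dimAt k i t = endUnitEquiv k i (unitIncl i ≫ (η_ t tᘁ ≫ evBar t) ≫ unitProj i) := by
    simp [dimAt, scalarAt, trR]
  rw [← h5, h0] at h4
  simp at h4

/-- `H⟨x t̄⟩` as a space of morphisms. -/
def ofPairLin (x t : C) : (𝟙_ C ⟶ x ⊗ tᘁ) ≃ₗ[k] (t ⟶ x) where
  toFun := ofPair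
  invFun := toPair
  map_add' f g := by simp [ofPair]
  map_smul' r f := by simp [ofPair]
  left_inv := toPair_ofPair
  right_inv := ofPair_toPair

lemma exists_trLin_ne_zero {i j : Gam C} {x t : C} [Simple t] (ht : Homogeneous i j t)
    {α : t ⟶ x} (h : α ≠ 0) : ∃ β : x ⟶ t, trLin k i t (α ≫ β) ≠ 0 := by
  obtain ⟨β, hβ⟩ := exists_comp_eq_id h
  exact ⟨β, by rw [hβ]; exact dimAt_ne_zero k ht⟩

lemma exists_trLin_ne_zero' {i j : Gam C} {x t : C} [Simple t] (ht : Homogeneous i j t)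
    {β : x ⟶ t} (h : β ≠ 0) : ∃ α : t ⟶ x, trLin k i t (α ≫ β) ≠ 0 := by
  obtain ⟨α, hα⟩ := exists_comp_eq_id' h
  exact ⟨α, by rw [hα]; exact dimAt_ne_zero k ht⟩

/-- The trace pairing as a bilinear map. -/
def pairingLin (i : Gam C) (x t : C) :
    (𝟙_ C ⟶ t ⊗ xᘁ) →ₗ[k] (𝟙_ C ⟶ x ⊗ tᘁ) →ₗ[k] k :=
  LinearMap.mk₂ k (fun β α => trLin k i t (ofPairLin k x t α ≫ ofPairLin k t x β))
    (by intros; simp) (by intros; simp) (by intros; simp) (by intros; simp)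

/-- A nonzero morphism from or to the simple t splits, and pairs with its splitting to d_t ≠ 0. The
pairing is therefore perfect, and any basis of one side has a dual basis on the other. -/
lemma nonempty_dualBases {i j : Gam C} {x t : C} [Simple t] (ht : Homogeneous i j t) :
    Nonempty (DualBases k i x t) := by
  have := LocallyFiniteCategory.finite_hom (k := k) (𝟙_ C) (x ⊗ tᘁ)
  have := LocallyFiniteCategory.finite_hom (k := k) (𝟙_ C) (t ⊗ xᘁ)
  have h1 : Function.Injective (pairingLin k i x t) := by
    rw [← LinearMap.ker_eq_bot, LinearMap.ker_eq_bot']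
    intro β hβ
    by_contra h0
    obtain ⟨α, hα⟩ := exists_trLin_ne_zero' k ht (β := ofPairLin k t x β) (by simpa using h0)
    have := LinearMap.congr_fun hβ ((ofPairLin k x t).symm α)
    exact hα (by simpa [pairingLin] using this)
  have h2 : Function.Injective (pairingLin k i x t).flip := by
    rw [← LinearMap.ker_eq_bot, LinearMap.ker_eq_bot']
    intro α hα
    by_contra h0
    obtain ⟨β, hβ⟩ := exists_trLin_ne_zero k ht (α := ofPairLin k x t α) (by simpa using h0)
    have := LinearMap.congr_fun hα ((ofPairLin k t x).symm β)
    exact hβ (by simpa [pairingLin] using this)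
  have := LinearMap.IsPerfPair.of_injective h1 h2
  let α := Module.finBasis k (𝟙_ C ⟶ x ⊗ tᘁ)
  refine ⟨⟨_, α, α.dualBasis.map (LinearMap.toPerfPair (pairingLin k i x t)).symm, ?_⟩⟩
  intro p q
  rw [pairing_eq_trLin]
  change pairingLin k i x t _ _ = _
  rw [← LinearMap.toPerfPair_apply]
  simp [Finsupp.single_apply, eq_comm]

variable {k}

/-- Two families of morphisms that resolve every morphism `t ⟶ X` with respect to the trace
pairing. -/
def IsResolving (i : Gam C) {t X : C} {ι : Type*} [Fintype ι] (A : ι → (t ⟶ X))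
    (B : ι → (X ⟶ t)) : Prop :=
  ∀ φ : t ⟶ X, ∑ m, trLin k i t (φ ≫ B m) • A m = φ

lemma DualBases.trLin_eq {i : Gam C} {t X : C} (D : DualBases k i X t) (p q : Fin D.n) :
    trLin k i t (ofPair (D.α q) ≫ ofPair (D.β p)) = if p = q then 1 else 0 := by
  rw [← pairing_eq_trLin, D.dual]

lemma DualBases.isResolving {i : Gam C} {t X : C} (D : DualBases k i X t) :
    IsResolving (k := k) i (fun p => ofPair (D.α p)) (fun p => ofPair (D.β p)) := by
  intro φ
  obtain ⟨α, rfl⟩ := (ofPairLin k X t).surjective φ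
  rw [← D.α.sum_repr α]
  generalize D.α.repr α = c
  have h : ∀ q, ofPair (D.α q) = ofPairLin k X t (D.α q) := fun _ => rfl
  have := D.trLin_eq
  simp only [h, map_sum, map_smul, Preadditive.sum_comp, Linear.smul_comp] at this ⊢
  simp [this]

lemma DualBases.sum_trLin_smul {i : Gam C} {t X : C} (D : DualBases k i X t) (ψ : X ⟶ t) :
    ∑ p, trLin k i t (ofPair (D.α p) ≫ ψ) • ofPair (D.β p) = ψ := by
  obtain ⟨β, rfl⟩ := (ofPairLin k t X).surjective ψ
  rw [← D.β.sum_repr β]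
  generalize D.β.repr β = c
  have h : ∀ q, ofPair (D.β q) = ofPairLin k t X (D.β q) := fun _ => rfl
  have := D.trLin_eq
  simp only [h, map_sum, map_smul, Preadditive.comp_sum, Linear.comp_smul] at this ⊢
  simp [this]

/-- Expand each B in the basis β and each α in the family A: both sides become the same double sum.
Hence ∑ A ⊗ B depends neither on the bases nor on the resolving family, which need not consist of
bases. -/
lemma IsResolving.sum_eq {i : Gam C} {t X : C} {ι : Type*} [Fintype ι] {A : ι → (t ⟶ X)}
    {B : ι → (X ⟶ t)} (h : IsResolving (k := k) i A B) (D : DualBases k i X t)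
    {M : Type*} [AddCommGroup M] [Module k M] (Ψ : (t ⟶ X) →ₗ[k] (X ⟶ t) →ₗ[k] M) :
    ∑ p, Ψ (ofPair (D.α p)) (ofPair (D.β p)) = ∑ m, Ψ (A m) (B m) := by
  have h1 : ∀ m, Ψ (A m) (B m) =
      ∑ p, trLin k i t (ofPair (D.α p) ≫ B m) • Ψ (A m) (ofPair (D.β p)) := by
    intro m
    conv_lhs => rw [← D.sum_trLin_smul (B m)]
    simp
  have h2 : ∀ p, Ψ (ofPair (D.α p)) (ofPair (D.β p)) =
      ∑ m, trLin k i t (ofPair (D.α p) ≫ B m) • Ψ (A m) (ofPair (D.β p)) := by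
    intro p
    conv_lhs => rw [← h (ofPair (D.α p))]
    simp
  simp_rw [h1, h2]
  exact Finset.sum_comm

/-- The resolution of the identity by simple labels. -/
lemma sum_dualBases_eq_id (S : SimpleReps C) {X : C}
    (D : ∀ t : Label S.carrier, DualBases k t.1 X t.obj) :
    ∑ t ∈ S.support X, ∑ p, dimAt k t.1 t.obj • (ofPair ((D t).β p) ≫ ofPair ((D t).α p)) =
      𝟙 X := by
  refine S.hom_ext fun s φ => ?_
  rw [Category.comp_id, Preadditive.comp_sum, Finset.sum_eq_single s]
  · rw [Preadditive.comp_sum]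
    conv_rhs => rw [← (D s).isResolving φ]
    refine Finset.sum_congr rfl fun p _ => ?_
    -- By Schur's lemma this composite is c • id, of trace c · d_s. The weight d_s in the sum turns
    -- the scalar c into this trace.
    obtain ⟨c, hc⟩ := exists_smul_id k (φ ≫ ofPair ((D s).β p))
    have h1 : trLin k s.1 s.obj (𝟙 _) = dimAt k s.1 s.obj := rfl
    rw [Linear.comp_smul, ← Category.assoc, ← hc]
    simp [h1, smul_smul, mul_comm]
  · intro t _ hts
    rw [Preadditive.comp_sum]
    refine Finset.sum_eq_zero fun p _ => ?_
    rw [Linear.comp_smul, ← Category.assoc, S.hom_eq_zero hts.symm (φ ≫ _)]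
    simp
  · intro hs
    rw [S.hom_eq_zero_of_notMem hs φ]; simp

/-- Resolving families for `F X`, where `F` is a linear functor, from those for `X` and for the
images under `F` of the simple labels. -/
lemma isResolving_map (S : SimpleReps C) {X s : C} {i : Gam C} (F : C ⥤ C) [F.Additive]
    [F.Linear k] (D : ∀ t : Label S.carrier, DualBases k t.1 X t.obj)
    (E : ∀ t : Label S.carrier, DualBases k i (F.obj t.obj) s) :
    IsResolving (k := k) i
      (fun m : Σ t : S.support X, Fin (D t).n × Fin (E t).n =>
        dimAt k m.1.1.1 m.1.1.obj •
          (ofPair ((E m.1).α m.2.2) ≫ F.map (ofPair ((D m.1).α m.2.1))))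
      (fun m => F.map (ofPair ((D m.1).β m.2.1)) ≫ ofPair ((E m.1).β m.2.2)) := by
  intro φ
  -- Insert the image under F of the resolution of id_X after φ, then expand each resulting map s ⟶
  -- F t in the dual bases E t.
  have hid := congrArg (fun f => φ ≫ F.map f) (sum_dualBases_eq_id S D)
  simp only [F.map_id, Category.comp_id] at hid
  conv_rhs => rw [← hid]
  refine (Fintype.sum_sigma _).trans ?_
  rw [Functor.map_sum, Preadditive.comp_sum]
  refine Eq.trans ?_ (Finset.sum_coe_sort _ _)
  refine Finset.sum_congr rfl fun t _ => ?_
  rw [Functor.map_sum, Preadditive.comp_sum, Fintype.sum_prod_type]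
  refine Finset.sum_congr rfl fun p _ => ?_
  have h := (E t).isResolving (φ ≫ F.map (ofPair ((D t).β p)))
  rw [F.map_smul, F.map_comp, Linear.comp_smul, ← Category.assoc]
  conv_rhs => rw [← h]
  simp only [Preadditive.sum_comp, Finset.smul_sum, Linear.smul_comp, Category.assoc]
  refine Finset.sum_congr rfl fun q _ => ?_
  rw [smul_comm]

end Linear

/-! ### Conjugation and associativity of gluing -/

section Glue

variable {C : Type u} [Category.{v} C] [MonoidalCategory C]

/-- By the interchange law, conjugating one factor and then the gluing is conjugating the gluing
once, by the composites that occur in `isResolving_map`. The next lemma is the mirror image. -/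
lemma glue_conj_left {a c d t s X z : C} (A' : s ⟶ t ⊗ z) (B' : t ⊗ z ⟶ s) (A : t ⟶ X)
    (B : X ⟶ t) (F : X ⊗ c ⟶ a ⊗ X) (H : z ⊗ d ⟶ c ⊗ z) :
    A' ▷ d ≫ ((α_ t z d).hom ≫ t ◁ H ≫ (α_ t c z).inv ≫ (A ▷ c ≫ F ≫ a ◁ B) ▷ z ≫
        (α_ a t z).hom) ≫ a ◁ B' =
      (A' ≫ A ▷ z) ▷ d ≫ ((α_ X z d).hom ≫ X ◁ H ≫ (α_ X c z).inv ≫ F ▷ z ≫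
        (α_ a X z).hom) ≫ a ◁ (B ▷ z ≫ B') := by
  calc _ = A' ▷ d ⊗≫ (t ◁ H ≫ A ▷ (c ⊗ z)) ⊗≫ (F ≫ a ◁ B) ▷ z ⊗≫ a ◁ B' := by monoidal
    _ = _ := by rw [whisker_exchange]; monoidal

lemma glue_conj_right {a b d t s x Y : C} (A' : s ⟶ x ⊗ t) (B' : x ⊗ t ⟶ s) (A : t ⟶ Y)
    (B : Y ⟶ t) (F : x ⊗ b ⟶ a ⊗ x) (G : Y ⊗ d ⟶ b ⊗ Y) :
    A' ▷ d ≫ ((α_ x t d).hom ≫ x ◁ (A ▷ d ≫ G ≫ b ◁ B) ≫ (α_ x b t).inv ≫ F ▷ t ≫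
        (α_ a x t).hom) ≫ a ◁ B' =
      (A' ≫ x ◁ A) ▷ d ≫ ((α_ x Y d).hom ≫ x ◁ G ≫ (α_ x b Y).inv ≫ F ▷ Y ≫
        (α_ a x Y).hom) ≫ a ◁ (x ◁ B ≫ B') := by
  calc _ = A' ▷ d ⊗≫ x ◁ (A ▷ d ≫ G) ⊗≫ ((x ⊗ b) ◁ B ≫ F ▷ t) ⊗≫ a ◁ B' := by monoidal
    _ = _ := by rw [whisker_exchange]; monoidal

variable [RightRigidCategory C] [PivotalCategory C]

lemma untube_glueTube_assoc {a b c d x y z : C} (f : TubeHom a b x) (g : TubeHom b c y)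
    (h : TubeHom c d z) :
    untube (glueTube (glueTube f g) h) =
      (α_ x y z).hom ▷ d ≫ untube (glueTube f (glueTube g h)) ≫ a ◁ (α_ x y z).inv := by
  simp only [untube_glueTube]
  monoidal

end Glue

/-! ### Resolving glued tubes -/

section Resolve

variable (k : Type w) [Field k]
variable {C : Type u} [Category.{v} C] [Abelian C] [Linear k C] [MonoidalCategory C]
  [MonoidalPreadditive C] [MonoidalLinear k C] [RightRigidCategory C] [PivotalCategory C]

/-- `untube` as a linear map. -/
def untubeLin (a c x : C) : TubeHom a c x →ₗ[k] (x ⊗ c ⟶ a ⊗ x) where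
  toFun := untube
  map_add' F G := by simp [untube, ofBar, uncurry]
  map_smul' r F := by simp [untube, ofBar, uncurry]

/-- The bilinear map `(A, B) ↦ A ▷ c ≫ G ≫ a ◁ B`. -/
def conjLin {a c X : C} (t : C) (G : X ⊗ c ⟶ a ⊗ X) :
    (t ⟶ X) →ₗ[k] (X ⟶ t) →ₗ[k] (t ⊗ c ⟶ a ⊗ t) :=
  LinearMap.mk₂ k (fun A B => A ▷ c ≫ G ≫ a ◁ B)
    (by intros; simp) (by intros; simp) (by intros; simp) (by intros; simp)

variable {k} [IsAlgClosed k] [LocallyFiniteCategory k C] [SemisimpleCategory C]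

lemma untube_resolve {i : Gam C} {a c X t : C} (D : DualBases k i X t) (F : TubeHom a c X) :
    untube (D.resolve a c F) =
      ∑ p, ofPair (D.α p) ▷ c ≫ untube F ≫ a ◁ ofPair (D.β p) := by
  change untubeLin k a c t _ = _
  rw [DualBases.resolve, LinearMap.sum_apply, map_sum]
  exact Finset.sum_congr rfl fun p _ => untube_sandwich _ _ _

lemma IsResolving.untube_resolve {i : Gam C} {a c X t : C} {ι : Type*} [Fintype ι]
    {A : ι → (t ⟶ X)} {B : ι → (X ⟶ t)} (h : IsResolving (k := k) i A B) (D : DualBases k i X t)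
    (F : TubeHom a c X) :
    untube (D.resolve a c F) = ∑ m, A m ▷ c ≫ untube F ≫ a ◁ B m := by
  rw [TubeAlg.untube_resolve]
  exact h.sum_eq D (conjLin k t (untube F))

lemma IsResolving.map_iso {i : Gam C} {X X' t : C} {ι : Type*} [Fintype ι]
    {A : ι → (t ⟶ X)} {B : ι → (X ⟶ t)} (h : IsResolving (k := k) i A B) (e : X ≅ X') :
    IsResolving (k := k) i (fun m => A m ≫ e.hom) (fun m => e.inv ≫ B m) := by
  intro φ
  have := congrArg (fun f => f ≫ e.hom) (h (φ ≫ e.inv))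
  simpa [Preadditive.sum_comp] using this

/-- Resolving a tube element along an isomorphism. -/
lemma resolve_eq_of_iso {i : Gam C} {a c X X' t : C} (D : DualBases k i X t)
    (D' : DualBases k i X' t) (e : X ≅ X') {F : TubeHom a c X} {F' : TubeHom a c X'}
    (h : untube F = e.hom ▷ c ≫ untube F' ≫ a ◁ e.inv) :
    D.resolve a c F = D'.resolve a c F' := by
  apply untube_injective
  rw [(D.isResolving.map_iso e).untube_resolve D', untube_resolve, h]
  simp

lemma resolve_eq {i : Gam C} {a c X t : C} (D D' : DualBases k i X t) :
    D.resolve a c = D'.resolve a c :=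
  LinearMap.ext fun _ => resolve_eq_of_iso D D' (Iso.refl X) (by simp)

/-- The choice of dual bases in `resolveAt` is immaterial. -/
lemma resolveAt_eq {i : Gam C} {a c X t : C} (D : DualBases k i X t) :
    resolveAt k i a c X t = D.resolve a c := by
  rw [resolveAt, dif_pos ⟨D⟩]
  exact resolve_eq _ _

lemma resolve_eq_zero {i : Gam C} {a c X t : C} (D : DualBases k i X t)
    (h : ∀ f : t ⟶ X, f = 0) : D.resolve a c = 0 := by
  ext F
  apply untube_injective
  rw [untube_resolve, LinearMap.zero_apply]
  change _ = untubeLin k a c t 0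
  rw [map_zero]
  exact Finset.sum_eq_zero fun p _ => by rw [h (ofPair _)]; simp

/-- This is the core of associativity: by `isResolving_map` for the functor – ⊗ z, the two-step
families with weight d_t resolve X ⊗ z, so the intermediate label t disappears. -/
lemma sum_resolve_glueTube_left (S : SimpleReps C) {i : Gam C} {a c d X z s : C}
    (D : ∀ t : Label S.carrier, DualBases k t.1 X t.obj)
    (E : ∀ t : Label S.carrier, DualBases k i (t.obj ⊗ z) s) (D₀ : DualBases k i (X ⊗ z) s)
    (F : TubeHom a c X) (h : TubeHom c d z) :
    ∑ t ∈ S.support X, dimAt k t.1 t.obj •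
        (E t).resolve a d (glueTube ((D t).resolve a c F) h) =
      D₀.resolve a d (glueTube F h) := by
  apply untube_injective
  rw [(isResolving_map S (tensorRight z) D E).untube_resolve D₀]
  refine Eq.trans ?_ (Fintype.sum_sigma _).symm
  change untubeLin k a d s _ = _
  rw [map_sum]
  refine Eq.trans (Finset.sum_coe_sort _ _).symm ?_
  refine Finset.sum_congr rfl fun t _ => ?_
  rw [map_smul, Fintype.sum_prod_type, Finset.sum_comm]
  change _ • untube _ = _
  rw [untube_resolve, Finset.smul_sum]
  refine Finset.sum_congr rfl fun q _ => ?_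
  rw [untube_glueTube, untube_resolve, untube_glueTube]
  simp only [sum_whiskerRight, Preadditive.sum_comp, Preadditive.comp_sum, Finset.smul_sum]
  refine Finset.sum_congr rfl fun p _ => ?_
  simp only [Functor.flip_obj_map, curriedTensor_map_app,
    MonoidalLinear.smul_whiskerRight, Linear.smul_comp]
  congr 1
  exact glue_conj_left _ _ _ _ _ _

/-- The mirror image, with the functor x ⊗ –. -/
lemma sum_resolve_glueTube_right (S : SimpleReps C) {i : Gam C} {a b d x Y s : C}
    (D : ∀ t : Label S.carrier, DualBases k t.1 Y t.obj)
    (E : ∀ t : Label S.carrier, DualBases k i (x ⊗ t.obj) s) (D₀ : DualBases k i (x ⊗ Y) s)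
    (f : TubeHom a b x) (G : TubeHom b d Y) :
    ∑ t ∈ S.support Y, dimAt k t.1 t.obj •
        (E t).resolve a d (glueTube f ((D t).resolve b d G)) =
      D₀.resolve a d (glueTube f G) := by
  apply untube_injective
  rw [(isResolving_map S (tensorLeft x) D E).untube_resolve D₀]
  refine Eq.trans ?_ (Fintype.sum_sigma _).symm
  change untubeLin k a d s _ = _
  rw [map_sum]
  refine Eq.trans (Finset.sum_coe_sort _ _).symm ?_
  refine Finset.sum_congr rfl fun t _ => ?_
  rw [map_smul, Fintype.sum_prod_type, Finset.sum_comm]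
  change _ • untube _ = _
  rw [untube_resolve, Finset.smul_sum]
  refine Finset.sum_congr rfl fun q _ => ?_
  rw [untube_glueTube, untube_resolve, untube_glueTube]
  simp only [whiskerLeft_sum, Preadditive.sum_comp, Preadditive.comp_sum, Finset.smul_sum]
  refine Finset.sum_congr rfl fun p _ => ?_
  simp only [curriedTensor_obj_map, MonoidalLinear.smul_whiskerRight, Linear.smul_comp]
  congr 1
  exact glue_conj_right _ _ _ _ _ _

end Resolve

lemma Label.incl_injective {C : Type u} [Category.{v} C] [Abelian C] [MonoidalCategory C]
    {S J : Gam C → Gam C → Set C} (hSJ : ∀ i j, S i j ⊆ J i j) : Function.Injective (Label.incl hSJ) := by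
  rintro ⟨i, j, X, hX⟩ ⟨i', j', Y, hY⟩ h
  simp only [Label.incl, Sigma.mk.injEq] at h
  obtain ⟨rfl, h⟩ := h
  simp only [heq_eq_eq, Sigma.mk.injEq] at h
  obtain ⟨rfl, h⟩ := h
  simp only [heq_eq_eq, Subtype.mk.injEq] at h
  subst h
  rfl

/-! ### Welding and its associativity -/

section Weld

variable {k : Type w} [Field k] [IsAlgClosed k]
variable {C : Type u} [Category.{v} C] [Abelian C] [Linear k C] [MonoidalCategory C]
  [MonoidalPreadditive C] [MonoidalLinear k C] [RightRigidCategory C]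
  [LocallyFiniteCategory k C] [SemisimpleCategory C] [PivotalCategory C]
variable {S : SimpleReps C} {J : Gam C → Gam C → Set C} (hSJ : ∀ i j, S.carrier i j ⊆ J i j)

lemma SimpleReps.nonempty_dualBases (S : SimpleReps C) (X : C) (t : Label S.carrier) :
    Nonempty (DualBases k t.1 X t.obj) :=
  TubeAlg.nonempty_dualBases k (S.homogeneous t.2.2.2)

variable (k) in
/-- A choice of dual bases. -/
def SimpleReps.dualBases (S : SimpleReps C) (X : C) (t : Label S.carrier) :
    DualBases k t.1 X t.obj :=
  (S.nonempty_dualBases X t).some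

lemma weldAt_apply {i : Gam C} {a b c t : C} {x y : Label J}
    (D : DualBases k i (x.obj ⊗ y.obj) t) (f : TubeHom a b x.obj) (g : TubeHom b c y.obj) :
    weldAt k i a b c x y t f g =
      (dimAt k x.1 x.obj * dimAt k y.1 y.obj) • D.resolve a c (glueTube f g) := by
  rw [← resolveAt_eq D]
  rfl

variable (S) in
lemma weldAt_eq_zero {a b c : C} {x y : Label J} {t : Label S.carrier}
    (ht : t ∉ S.support (x.obj ⊗ y.obj)) : weldAt k t.1 a b c x y t.obj = 0 := by
  ext f g
  rw [weldAt_apply (S.dualBases k _ t), resolve_eq_zero _ (S.hom_eq_zero_of_notMem ht)]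
  simp

open Classical in
variable (k) in
/-- The inclusion of the summand of a simple label into the space of tubes. -/
def simpleIncl (a c : C) (t : Label S.carrier) : TubeHom a c t.obj →ₗ[k] TubeSpace J a c :=
  DirectSum.lof k (Label J) (fun z => TubeHom a c z.obj) (t.incl hSJ)

variable (S) in
open Classical in
-- The index set may be any finite set containing the support, so that different weldings can be
-- summed over a common one.
lemma weldHom_eq_sum {a b c : C} {x y : Label J} {T : Finset (Label S.carrier)}
    (hT : S.support (x.obj ⊗ y.obj) ⊆ T) (f : TubeHom a b x.obj) (g : TubeHom b c y.obj) :
    weldHom k S hSJ a b c x y f g = ∑ t ∈ T,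
      simpleIncl k hSJ a c t (weldAt k t.1 a b c x y t.obj f g) := by
  rw [weldHom, finsum_eq_sum_of_support_subset (s := T)]
  · simp only [LinearMap.sum_apply]
    rfl
  · intro t ht
    by_contra hcon
    refine ht ?_
    have h0 := weldAt_eq_zero (k := k) S (a := a) (b := b) (c := c) fun h => hcon (hT h)
    exact LinearMap.ext fun f => LinearMap.ext fun g =>
      (congrArg (DirectSum.lof k (Label J) (fun z => TubeHom a c z.obj) (t.incl hSJ))
        (LinearMap.congr_fun (LinearMap.congr_fun h0 f) g)).trans (map_zero _)

variable (S) in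
open Classical in
lemma weld_lof_lof {a b c : C} (x y : Label J) (f : TubeHom a b x.obj) (g : TubeHom b c y.obj) :
    weld k S hSJ a b c (DirectSum.lof k (Label J) (fun z => TubeHom a b z.obj) x f)
      (DirectSum.lof k (Label J) (fun z => TubeHom b c z.obj) y g) =
      weldHom k S hSJ a b c x y f g := by
  rw [weld, DirectSum.toModule_lof, LinearMap.flip_apply, DirectSum.toModule_lof,
    LinearMap.flip_apply]

variable (S) in
open Classical in
lemma weld_lof_lof_apply_incl {a b c : C} (x y : Label J) (f : TubeHom a b x.obj)
    (g : TubeHom b c y.obj) (t : Label S.carrier) :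
    weld k S hSJ a b c (DirectSum.lof k (Label J) (fun z => TubeHom a b z.obj) x f)
      (DirectSum.lof k (Label J) (fun z => TubeHom b c z.obj) y g) (t.incl hSJ) =
      weldAt k t.1 a b c x y t.obj f g := by
  rw [weld_lof_lof, weldHom_eq_sum S hSJ (T := insert t (S.support (x.obj ⊗ y.obj)))
    (Finset.subset_insert _ _), DFinsupp.finsetSum_apply, Finset.sum_eq_single t]
  · exact DirectSum.lof_apply k _ _
  · intro s _ hs
    exact DirectSum.of_eq_of_ne _ _ _ fun h => hs (Label.incl_injective hSJ h).symm
  · intro h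
    exact absurd (Finset.mem_insert_self _ _) h

variable (S) in
open Classical in
lemma weld_lof_lof_apply_of_notMem {a b c : C} (x y : Label J) (f : TubeHom a b x.obj)
    (g : TubeHom b c y.obj) (z : Label J) (hz : z ∉ Set.range (Label.incl hSJ)) :
    weld k S hSJ a b c (DirectSum.lof k (Label J) (fun z => TubeHom a b z.obj) x f)
      (DirectSum.lof k (Label J) (fun z => TubeHom b c z.obj) y g) z = 0 := by
  rw [weld_lof_lof, weldHom_eq_sum S hSJ (Finset.Subset.refl _), DFinsupp.finsetSum_apply]
  exact Finset.sum_eq_zero fun s _ =>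
    DirectSum.of_eq_of_ne _ _ _ fun h => hz ⟨s, h.symm⟩

lemma weldAt_weldAt_left {i : Gam C} {a b c d s : C} {x y z : Label J} {t : Label S.carrier}
    (D : DualBases k t.1 (x.obj ⊗ y.obj) t.obj) (E : DualBases k i (t.obj ⊗ z.obj) s)
    (f : TubeHom a b x.obj) (g : TubeHom b c y.obj) (h : TubeHom c d z.obj) :
    weldAt k i a c d (t.incl hSJ) z s (weldAt k t.1 a b c x y t.obj f g) h =
      ((dimAt k x.1 x.obj * dimAt k y.1 y.obj) * (dimAt k t.1 t.obj * dimAt k z.1 z.obj)) •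
        E.resolve a d (glueTube (D.resolve a c (glueTube f g)) h) := by
  refine (weldAt_apply (x := t.incl hSJ) (y := z) E _ h).trans ?_
  change (dimAt k t.1 t.obj * dimAt k z.1 z.obj) • E.resolve a d
    (glueTube (x := t.obj) (weldAt k t.1 a b c x y t.obj f g) h) = _
  rw [weldAt_apply D]
  change _ • E.resolve _ _ (glueTubeLin k _ _ _ _ _ _ _) =
    _ • E.resolve _ _ (glueTubeLin k _ _ _ _ _ _ _)
  rw [map_smul, LinearMap.smul_apply, map_smul, smul_smul, mul_comm]

lemma weldAt_weldAt_right {i : Gam C} {a b c d s : C} {x y z : Label J} {t : Label S.carrier}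
    (D : DualBases k t.1 (y.obj ⊗ z.obj) t.obj) (E : DualBases k i (x.obj ⊗ t.obj) s)
    (f : TubeHom a b x.obj) (g : TubeHom b c y.obj) (h : TubeHom c d z.obj) :
    weldAt k i a b d x (t.incl hSJ) s f (weldAt k t.1 b c d y z t.obj g h) =
      ((dimAt k y.1 y.obj * dimAt k z.1 z.obj) * (dimAt k x.1 x.obj * dimAt k t.1 t.obj)) •
        E.resolve a d (glueTube f (D.resolve b d (glueTube g h))) := by
  refine (weldAt_apply (x := x) (y := t.incl hSJ) E f _).trans ?_
  change (dimAt k x.1 x.obj * dimAt k t.1 t.obj) • E.resolve a d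
    (glueTube (y := t.obj) f (weldAt k t.1 b c d y z t.obj g h)) = _
  rw [weldAt_apply D]
  change _ • E.resolve _ _ (glueTubeLin k _ _ _ _ _ _ _) =
    _ • E.resolve _ _ (glueTubeLin k _ _ _ _ _ _ _)
  rw [map_smul, map_smul, smul_smul, mul_comm]

variable (S) in
-- Both sides are d_x d_y d_z times a resolution to s of the triple gluing; the factor d_t
-- contributed by the second welding is what the sum over t consumes.
lemma sum_weldAt_assoc {a b c d : C} (x y z : Label J) (s : Label S.carrier)
    (f : TubeHom a b x.obj) (g : TubeHom b c y.obj) (h : TubeHom c d z.obj) :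
    ∑ t ∈ S.support (x.obj ⊗ y.obj), weldAt k s.1 a c d (t.incl hSJ) z s.obj
        (weldAt k t.1 a b c x y t.obj f g) h =
      ∑ t ∈ S.support (y.obj ⊗ z.obj), weldAt k s.1 a b d x (t.incl hSJ) s.obj f
        (weldAt k t.1 b c d y z t.obj g h) := by
  have hl := sum_resolve_glueTube_left S (z := z.obj) (s := s.obj) (S.dualBases k _)
    (fun t => S.dualBases k (t.obj ⊗ z.obj) s) (S.dualBases k _ s) (glueTube f g) h
  have hr := sum_resolve_glueTube_right S (x := x.obj) (s := s.obj) (S.dualBases k _)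
    (fun t => S.dualBases k (x.obj ⊗ t.obj) s) (S.dualBases k _ s) f (glueTube g h)
  rw [resolve_eq_of_iso (S.dualBases k ((x.obj ⊗ y.obj) ⊗ z.obj) s)
    (S.dualBases k (x.obj ⊗ (y.obj ⊗ z.obj)) s) (α_ _ _ _) (untube_glueTube_assoc f g h),
    ← hr] at hl
  have hl' := congrArg (fun F => (dimAt k x.1 x.obj * dimAt k y.1 y.obj * dimAt k z.1 z.obj) • F) hl
  simp only [Finset.smul_sum, smul_smul] at hl'
  convert hl' using 2 with t _ t _
  · exact (weldAt_weldAt_left hSJ (S.dualBases k _ t) _ f g h).trans (by congr 1; ring)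
  · exact (weldAt_weldAt_right hSJ (S.dualBases k _ t) _ f g h).trans (by congr 1; ring)

open Classical in
lemma weld_simpleIncl_lof {a c d : C} (t : Label S.carrier) (z : Label J)
    {U : Finset (Label S.carrier)} (hU : S.support (t.obj ⊗ z.obj) ⊆ U)
    (F : TubeHom a c t.obj) (h : TubeHom c d z.obj) :
    weld k S hSJ a c d (simpleIncl k hSJ a c t F)
        (DirectSum.lof k (Label J) (fun z => TubeHom c d z.obj) z h) =
      ∑ s ∈ U, simpleIncl k hSJ a d s (weldAt k s.1 a c d (t.incl hSJ) z s.obj F h) :=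
  (weld_lof_lof S hSJ (t.incl hSJ) z F h).trans
    (weldHom_eq_sum S hSJ (x := t.incl hSJ) (y := z) hU F h)

open Classical in
lemma weld_lof_simpleIncl {a b d : C} (x : Label J) (t : Label S.carrier)
    {U : Finset (Label S.carrier)} (hU : S.support (x.obj ⊗ t.obj) ⊆ U)
    (f : TubeHom a b x.obj) (G : TubeHom b d t.obj) :
    weld k S hSJ a b d (DirectSum.lof k (Label J) (fun z => TubeHom a b z.obj) x f)
        (simpleIncl k hSJ b d t G) =
      ∑ s ∈ U, simpleIncl k hSJ a d s (weldAt k s.1 a b d x (t.incl hSJ) s.obj f G) :=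
  (weld_lof_lof S hSJ x (t.incl hSJ) f G).trans
    (weldHom_eq_sum S hSJ (x := x) (y := t.incl hSJ) hU f G)

variable (S) in
open Classical in
/-- Welding is associative. -/
lemma weld_assoc (a b c d : C) (f : TubeSpace J a b) (g : TubeSpace J b c) (h : TubeSpace J c d) :
    weld k S hSJ a c d (weld k S hSJ a b c f g) h =
      weld k S hSJ a b d f (weld k S hSJ b c d g h) := by
  induction f using DirectSum.induction_on with
  | zero => simp
  | add f f' hf hf' => simp only [map_add, LinearMap.add_apply, hf, hf']
  | of x f =>
  induction g using DirectSum.induction_on with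
  | zero => simp
  | add g g' hg hg' => simp only [map_add, LinearMap.add_apply, hg, hg']
  | of y g =>
  induction h using DirectSum.induction_on with
  | zero => simp
  | add h h' hh hh' => simp only [map_add, hh, hh']
  | of z h =>
  have e : ∀ (a b : C) (x : Label J) (f : TubeHom a b x.obj),
    DirectSum.of (fun z : Label J => TubeHom a b z.obj) x f =
      DirectSum.lof k (Label J) (fun z => TubeHom a b z.obj) x f := fun _ _ _ _ => rfl
  simp only [e]
  -- All simple labels that can occur in either iterated welding; a common set allows the sums over
  -- t and s to be exchanged.
  let U : Finset (Label S.carrier) :=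
    ((S.support (x.obj ⊗ y.obj)).biUnion fun t => S.support (t.obj ⊗ z.obj)) ∪
      ((S.support (y.obj ⊗ z.obj)).biUnion fun t => S.support (x.obj ⊗ t.obj))
  have hl : ∀ t ∈ S.support (x.obj ⊗ y.obj), S.support (t.obj ⊗ z.obj) ⊆ U :=
    fun t ht => (Finset.subset_biUnion_of_mem (fun t : Label S.carrier =>
      S.support (t.obj ⊗ z.obj)) ht).trans Finset.subset_union_left
  have hr : ∀ t ∈ S.support (y.obj ⊗ z.obj), S.support (x.obj ⊗ t.obj) ⊆ U :=
    fun t ht => (Finset.subset_biUnion_of_mem (fun t : Label S.carrier =>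
      S.support (x.obj ⊗ t.obj)) ht).trans Finset.subset_union_right
  rw [weld_lof_lof, weld_lof_lof, weldHom_eq_sum S hSJ (Finset.Subset.refl _),
    weldHom_eq_sum S hSJ (Finset.Subset.refl _), map_sum, map_sum, LinearMap.sum_apply]
  rw [Finset.sum_congr rfl fun t ht => weld_simpleIncl_lof hSJ t z (hl t ht) _ h,
    Finset.sum_congr rfl fun t ht => weld_lof_simpleIncl hSJ x t (hr t ht) f _]
  rw [Finset.sum_comm, Finset.sum_comm (s := S.support (y.obj ⊗ z.obj))]
  refine Finset.sum_congr rfl fun s _ => ?_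
  rw [← map_sum, ← map_sum, sum_weldAt_assoc]

end Weld

/-! ### Gluing with a unit tube -/

section UnitConj

variable {C : Type u} [Category.{v} C] [MonoidalCategory C]

/-- A unit tube factors through the strand 𝟙, so f slides past it and is conjugated by the maps that
absorb u into x. -/
lemma glue_unit_left {a b x u : C} (p : u ⟶ 𝟙_ C) (q : 𝟙_ C ⟶ u) (f : x ⊗ b ⟶ a ⊗ x) :
    (α_ u x b).hom ≫ u ◁ f ≫ (α_ u a x).inv ≫
        (p ▷ a ≫ (λ_ a).hom ≫ (ρ_ a).inv ≫ a ◁ q) ▷ x ≫ (α_ a u x).hom =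
      (p ▷ x ≫ (λ_ x).hom) ▷ b ≫ f ≫ a ◁ ((λ_ x).inv ≫ q ▷ x) := by
  calc _ = 𝟙 _ ⊗≫ (u ◁ f ≫ p ▷ (a ⊗ x)) ⊗≫ a ◁ q ▷ x ⊗≫ 𝟙 _ := by monoidal
    _ = _ := by rw [whisker_exchange]; monoidal

lemma glue_unit_right {a b x u : C} (p : u ⟶ 𝟙_ C) (q : 𝟙_ C ⟶ u) (f : x ⊗ b ⟶ a ⊗ x) :
    (α_ x u b).hom ≫ x ◁ (p ▷ b ≫ (λ_ b).hom ≫ (ρ_ b).inv ≫ b ◁ q) ≫ (α_ x b u).inv ≫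
        f ▷ u ≫ (α_ a x u).hom =
      (x ◁ p ≫ (ρ_ x).hom) ▷ b ≫ f ≫ a ◁ ((ρ_ x).inv ≫ x ◁ q) := by
  calc _ = 𝟙 _ ⊗≫ x ◁ p ▷ b ⊗≫ ((x ⊗ b) ◁ q ≫ f ▷ u) ⊗≫ 𝟙 _ := by monoidal
    _ = _ := by rw [whisker_exchange]; monoidal

end UnitConj

section TubeIncl

variable {k : Type w} [Field k]
variable {C : Type u} [Category.{v} C] [Abelian C] [Linear k C] [MonoidalCategory C]
  [RightRigidCategory C]

open Classical in
lemma of_eq_tubeIncl (S : SimpleReps C) (I : Gam C → Set C) (a b : DiagLabel I)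
    (f : TubeSpace S.carrier a.obj b.obj) :
    DirectSum.of (fun p : DiagLabel I × DiagLabel I => TubeSpace S.carrier p.1.obj p.2.obj) (a, b)
      f = tubeIncl k S I a b f :=
  rfl

end TubeIncl

/-! ### Units for welding and local units -/

section Units

variable {k : Type w} [Field k] [IsAlgClosed k]
variable {C : Type u} [Category.{v} C] [Abelian C] [Linear k C] [MonoidalCategory C]
  [MonoidalPreadditive C] [MonoidalLinear k C] [RightRigidCategory C]
  [LocallyFiniteCategory k C] [SemisimpleCategory C] [PivotalCategory C]

/-- By Schur's lemma φ = c • id, with trace c · d_t; the inverse dimension compensates. -/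
lemma isResolving_id {i j : Gam C} {t : C} [Simple t] (ht : Homogeneous i j t) :
    IsResolving (k := k) i (fun _ : Unit => (dimAt k i t)⁻¹ • 𝟙 t) (fun _ => 𝟙 t) := by
  intro φ
  obtain ⟨c, rfl⟩ := exists_smul_id k φ
  have h : trLin k i t (𝟙 t) = dimAt k i t := rfl
  simp [h, smul_smul, dimAt_ne_zero k ht]

lemma resolve_of_simple {i j : Gam C} {a c t : C} [Simple t] (ht : Homogeneous i j t)
    (D : DualBases k i t t) (F : TubeHom a c t) :
    D.resolve a c F = (dimAt k i t)⁻¹ • F := by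
  apply untube_injective
  rw [(isResolving_id ht).untube_resolve D]
  change _ = untubeLin k a c t _
  rw [map_smul]
  simp
  rfl

variable (S : SimpleReps C)

open Classical in
-- Since x ⊗ y is isomorphic to the simple z, only the component at z survives, and resolving there
-- contributes d_z⁻¹.
lemma weld_lof_lof_of_iso {a b c : C} {x y z : Label S.carrier} (e : x.obj ⊗ y.obj ≅ z.obj)
    (f : TubeHom a b x.obj) (g : TubeHom b c y.obj) (h : TubeHom a c z.obj)
    (he : untube (glueTube f g) = e.hom ▷ c ≫ untube h ≫ a ◁ e.inv) :
    weld k S (fun _ _ => subset_rfl) a b c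
        (DirectSum.lof k (Label S.carrier) (fun z => TubeHom a b z.obj) x f)
        (DirectSum.lof k (Label S.carrier) (fun z => TubeHom b c z.obj) y g) =
      ((dimAt k x.1 x.obj * dimAt k y.1 y.obj) * (dimAt k z.1 z.obj)⁻¹) •
        DirectSum.lof k (Label S.carrier) (fun z => TubeHom a c z.obj) z h := by
  refine DFinsupp.ext fun t => ?_
  refine (weld_lof_lof_apply_incl S _ x y f g t).trans ?_
  rw [weldAt_apply (S.dualBases k _ t)]
  by_cases ht : t = z
  · subst ht
    rw [resolve_eq_of_iso _ (S.dualBases k t.obj t) e he,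
      resolve_of_simple (S.homogeneous t.2.2.2), smul_smul]
    exact congrArg _ (DirectSum.lof_apply (M := fun z : Label S.carrier => TubeHom a c z.obj)
      k t h).symm
  · rw [resolve_eq_zero _ fun f => by
      rw [← cancel_mono e.hom, S.hom_eq_zero ht (f ≫ e.hom), zero_comp]]
    rw [LinearMap.zero_apply, smul_zero]
    symm
    exact (congrArg _ (DirectSum.of_eq_of_ne
      (β := fun z : Label S.carrier => TubeHom a c z.obj) z t h ht)).trans
      (smul_zero (A := TubeHom a c t.obj) _)

open Classical in
/-- The unit morphism of `a` is a left unit for welding. -/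
lemma weld_unitHom_left {i : Gam C} {a b : C} (ha : Homogeneous i i a)
    (f : TubeSpace S.carrier a b) :
    weld k S (fun _ _ => subset_rfl) a a b
        (DirectSum.lof k (Label S.carrier) (fun z => TubeHom a a z.obj) (unitLabel S i)
          (unitHom a (unitLabelIso S i))) f = f := by
  induction f using DirectSum.induction_on with
  | zero => simp
  | add f f' hf hf' => rw [map_add, hf, hf']
  | of x f =>
  -- If the components match, the unitor gives u ⊗ x ≅ x and the coefficient is d_u d_x d_x⁻¹ = 1.
  -- Otherwise a ⊗ x = 0, so f = 0.
  by_cases hx : i = x.1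
  · have hx' := S.homogeneous x.2.2.2
    subst hx
    let φ := unitLabelIso S x.1
    let e : (unitLabel S x.1).obj ⊗ x.obj ≅ x.obj :=
      { hom := (φ.inv ≫ unitIncl x.1) ▷ x.obj ≫ (λ_ _).hom
        inv := (λ_ _).inv ≫ (unitProj x.1 ≫ φ.hom) ▷ x.obj
        hom_inv_id := by
          rw [Category.assoc, Iso.hom_inv_id_assoc, ← comp_whiskerRight, Category.assoc,
            ← Category.assoc (unitIncl x.1), unitIncl_proj, Category.id_comp, φ.inv_hom_id,
            id_whiskerRight]
        inv_hom_id := by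
          rw [Category.assoc, ← comp_whiskerRight_assoc, Category.assoc, φ.hom_inv_id_assoc,
            unitProj_incl]
          refine (congrArg (fun g => (λ_ x.obj).inv ≫ g ≫ (λ_ x.obj).hom)
            hx'.whiskerRight_eq).trans ?_
          simp }
    refine (weld_lof_lof_of_iso S e _ f f ?_).trans ?_
    · rw [untube_glueTube, untube_unitHom, glue_unit_left]
    · have h1 : dimAt k (unitLabel S x.1).1 (unitLabel S x.1).obj = 1 :=
        dimAt_of_iso_unitObj k _ φ
      rw [h1, one_mul, mul_inv_cancel₀ (dimAt_ne_zero k (S.homogeneous x.2.2.2)), one_smul]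
      rfl
  · have : f = 0 := by
      refine (map_eq_zero_iff (untubeLin k _ _ _) untube_injective).1 ?_
      exact ha.hom_tensor_eq_zero (S.homogeneous x.2.2.2) hx _
    simp [this]

open Classical in
/-- The unit morphism of `b` is a right unit for welding. -/
lemma weld_unitHom_right {i : Gam C} {a b : C} (hb : Homogeneous i i b)
    (f : TubeSpace S.carrier a b) :
    weld k S (fun _ _ => subset_rfl) a b b f
        (DirectSum.lof k (Label S.carrier) (fun z => TubeHom b b z.obj) (unitLabel S i)
          (unitHom b (unitLabelIso S i))) = f := by
  induction f using DirectSum.induction_on with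
  | zero => simp
  | add f f' hf hf' => rw [map_add, LinearMap.add_apply, hf, hf']
  | of x f =>
  -- As for the left unit; if the components do not match, now x ⊗ b = 0.
  by_cases hx : x.2.1 = i
  · have hx' := S.homogeneous x.2.2.2
    subst hx
    let φ := unitLabelIso S x.2.1
    let e : x.obj ⊗ (unitLabel S x.2.1).obj ≅ x.obj :=
      { hom := x.obj ◁ (φ.inv ≫ unitIncl x.2.1) ≫ (ρ_ _).hom
        inv := (ρ_ _).inv ≫ x.obj ◁ (unitProj x.2.1 ≫ φ.hom)
        hom_inv_id := by
          rw [Category.assoc, Iso.hom_inv_id_assoc, ← MonoidalCategory.whiskerLeft_comp,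
            Category.assoc, ← Category.assoc (unitIncl x.2.1), unitIncl_proj, Category.id_comp,
            φ.inv_hom_id, MonoidalCategory.whiskerLeft_id]
        inv_hom_id := by
          rw [Category.assoc, ← MonoidalCategory.whiskerLeft_comp_assoc, Category.assoc,
            φ.hom_inv_id_assoc, unitProj_incl]
          refine (congrArg (fun g => (ρ_ x.obj).inv ≫ g ≫ (ρ_ x.obj).hom)
            hx'.whiskerLeft_eq).trans ?_
          simp }
    refine (weld_lof_lof_of_iso S e f _ f ?_).trans ?_
    · rw [untube_glueTube, untube_unitHom, glue_unit_right]
    · have h1 : dimAt k (unitLabel S x.2.1).1 (unitLabel S x.2.1).obj = 1 :=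
        dimAt_of_iso_unitObj k _ φ
      rw [h1, mul_one, mul_inv_cancel₀ (dimAt_ne_zero k (S.homogeneous x.2.2.2)), one_smul]
      rfl
  · have : f = 0 := by
      refine (map_eq_zero_iff (untubeLin k _ _ _) untube_injective).1 ?_
      exact (S.homogeneous x.2.2.2).tensor_hom_eq_zero hb hx _
    simp [this]

/-! The tube algebra -/

variable (I : Gam C → Set C)

lemma tubeMul_incl_incl (a b c : DiagLabel I) (f : TubeSpace S.carrier a.obj b.obj)
    (g : TubeSpace S.carrier b.obj c.obj) :
    tubeMul k S I (tubeIncl k S I a b f) (tubeIncl k S I b c g) =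
      tubeIncl k S I a c (weld k S (fun _ _ => subset_rfl) a.obj b.obj c.obj f g) := by
  rw [tubeMul, tubeIncl, tubeIncl, DirectSum.toModule_lof, LinearMap.flip_apply,
    DirectSum.toModule_lof, LinearMap.flip_apply, tubeMulAt, dif_pos rfl]
  rfl

lemma tubeMul_incl_incl_of_ne (a b b' c : DiagLabel I) (f : TubeSpace S.carrier a.obj b.obj)
    (g : TubeSpace S.carrier b'.obj c.obj) (h : b ≠ b') :
    tubeMul k S I (tubeIncl k S I a b f) (tubeIncl k S I b' c g) = 0 := by
  rw [tubeMul, tubeIncl, tubeIncl, DirectSum.toModule_lof, LinearMap.flip_apply,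
    DirectSum.toModule_lof, LinearMap.flip_apply, tubeMulAt, dif_neg h]
  rfl

open Classical in
lemma tubeMul_assoc (f g h : Tube S I) :
    tubeMul k S I f (tubeMul k S I g h) = tubeMul k S I (tubeMul k S I f g) h := by
  induction f using DirectSum.induction_on with
  | zero => simp
  | add f f' hf hf' => simpa only [map_add, LinearMap.add_apply] using congrArg₂ (· + ·) hf hf'
  | of p f =>
  obtain ⟨a, b⟩ := p
  rw [of_eq_tubeIncl (k := k)]
  induction g using DirectSum.induction_on with
  | zero => simp
  | add f f' hf hf' => simpa only [map_add, LinearMap.add_apply] using congrArg₂ (· + ·) hf hf'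
  | of p g =>
  obtain ⟨b', c⟩ := p
  rw [of_eq_tubeIncl (k := k)]
  induction h using DirectSum.induction_on with
  | zero => simp
  | add f f' hf hf' => simpa only [map_add] using congrArg₂ (· + ·) hf hf'
  | of p h =>
  obtain ⟨c', d⟩ := p
  rw [of_eq_tubeIncl (k := k)]
  by_cases hb : b = b'
  · subst hb
    by_cases hc : c = c'
    · subst hc
      simp only [tubeMul_incl_incl, weld_assoc]
    · rw [tubeMul_incl_incl, tubeMul_incl_incl_of_ne _ _ _ _ _ _ _ _ hc,
        tubeMul_incl_incl_of_ne _ _ _ _ _ _ _ _ hc, map_zero]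
  · rw [tubeMul_incl_incl_of_ne _ _ _ _ _ _ _ _ hb, map_zero, LinearMap.zero_apply]
    by_cases hc : c = c'
    · subst hc
      rw [tubeMul_incl_incl, tubeMul_incl_incl_of_ne _ _ _ _ _ _ _ _ hb]
    · rw [tubeMul_incl_incl_of_ne _ _ _ _ _ _ _ _ hc, map_zero]

variable {I}

open Classical in
lemma tubeUnitSum_mul_incl (hI : ∀ i, ∀ a ∈ I i, Homogeneous i i a)
    (F : Finset (DiagLabel I)) (a b : DiagLabel I)
    (f : TubeSpace S.carrier a.obj b.obj) :
    tubeMul k S I (tubeUnitSum k S I F) (tubeIncl k S I a b f) =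
      if a ∈ F then tubeIncl k S I a b f else 0 := by
  rw [tubeUnitSum, map_sum, LinearMap.sum_apply, ← Finset.sum_ite_eq' F a
    (fun _ => tubeIncl k S I a b f)]
  refine Finset.sum_congr rfl fun c _ => ?_
  by_cases h : c = a
  · subst h
    rw [if_pos rfl, tubeUnit, tubeMul_incl_incl, weld_unitHom_left S (hI _ _ c.2.2)]
  · rw [if_neg h, tubeUnit, tubeMul_incl_incl_of_ne _ _ _ _ _ _ _ _ h]

open Classical in
lemma incl_mul_tubeUnitSum (hI : ∀ i, ∀ a ∈ I i, Homogeneous i i a)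
    (F : Finset (DiagLabel I)) (a b : DiagLabel I)
    (f : TubeSpace S.carrier a.obj b.obj) :
    tubeMul k S I (tubeIncl k S I a b f) (tubeUnitSum k S I F) =
      if b ∈ F then tubeIncl k S I a b f else 0 := by
  rw [tubeUnitSum, map_sum, ← Finset.sum_ite_eq F b (fun _ => tubeIncl k S I a b f)]
  refine Finset.sum_congr rfl fun c _ => ?_
  by_cases h : b = c
  · subst h
    rw [if_pos rfl, tubeUnit, tubeMul_incl_incl, weld_unitHom_right S (hI _ _ b.2.2)]
  · rw [if_neg h, tubeUnit, tubeMul_incl_incl_of_ne _ _ _ _ _ _ _ _ h]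

lemma tubeUnitSum_idem (hI : ∀ i, ∀ a ∈ I i, Homogeneous i i a)
    (F : Finset (DiagLabel I)) :
    tubeMul k S I (tubeUnitSum k S I F) (tubeUnitSum k S I F) = tubeUnitSum k S I F := by
  have h : ∀ a ∈ F, tubeMul k S I (tubeUnitSum k S I F) (tubeUnit k S I a) = tubeUnit k S I a := by
    intro a ha
    rw [tubeUnit, tubeUnitSum_mul_incl S hI, if_pos ha]
  conv_lhs => rw [tubeUnitSum.eq_def k S I F, map_sum, ← tubeUnitSum.eq_def k S I F]
  exact Finset.sum_congr rfl h

open Classical in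
-- On a summand T_{a;b}, e_F acts on the left as the indicator of a ∈ F and on the right as that of
-- b ∈ F.
lemma tubeUnitSum_mul_mul_apply (hI : ∀ i, ∀ a ∈ I i, Homogeneous i i a)
    (F : Finset (DiagLabel I)) (f : Tube S I)
    (p : DiagLabel I × DiagLabel I) :
    tubeMul k S I (tubeMul k S I (tubeUnitSum k S I F) f) (tubeUnitSum k S I F) p =
      if p.1 ∈ F ∧ p.2 ∈ F then f p else 0 := by
  induction f using DirectSum.induction_on with
  | zero => simp
  | add f g hf hg =>
    rw [map_add, map_add, LinearMap.add_apply, DirectSum.add_apply, hf, hg]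
    split_ifs <;> simp
  | of q f =>
    obtain ⟨a, b⟩ := q
    rw [of_eq_tubeIncl (k := k), tubeUnitSum_mul_incl S hI]
    by_cases hp : p = (a, b)
    · subst hp
      by_cases ha : a ∈ F
      · rw [if_pos ha, incl_mul_tubeUnitSum S hI]
        by_cases hb : b ∈ F
        · rw [if_pos hb, if_pos ⟨ha, hb⟩]
        · rw [if_neg hb, if_neg fun h => hb h.2]; rfl
      · rw [if_neg ha, if_neg fun h => ha h.1, map_zero]; rfl
    · have h0 : tubeIncl k S I a b f p = 0 := DirectSum.of_eq_of_ne
        (β := fun p : DiagLabel I × DiagLabel I => TubeSpace S.carrier p.1.obj p.2.obj) _ _ _ hp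
      rw [h0, ite_self]
      split_ifs
      · rw [incl_mul_tubeUnitSum S hI]
        split_ifs
        · exact h0
        · rfl
      · rw [map_zero]; rfl

lemma exists_tubeUnitSum (hI : ∀ i, ∀ a ∈ I i, Homogeneous i i a)
    (V : Submodule k (Tube S I)) [FiniteDimensional k V] :
    ∃ F : Finset (DiagLabel I), ∀ v ∈ V,
      tubeMul k S I (tubeMul k S I (tubeUnitSum k S I F) v) (tubeUnitSum k S I F) = v := by
  classical
  obtain ⟨s, hs⟩ := (Submodule.fg_iff_finiteDimensional V).2 inferInstance
  -- All row and column labels in the supports of a finite spanning set of V.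
  let F := s.biUnion fun v => v.support.image Prod.fst ∪ v.support.image Prod.snd
  refine ⟨F, fun v hv => ?_⟩
  rw [← hs] at hv
  induction hv using Submodule.span_induction with
  | zero => simp
  | add f g _ _ hf hg => rw [map_add, map_add, LinearMap.add_apply, hf, hg]
  | smul r f _ hf => rw [map_smul, map_smul, LinearMap.smul_apply, hf]
  | mem v hv =>
    refine DFinsupp.ext fun p => ?_
    refine (tubeUnitSum_mul_mul_apply S hI F v p).trans ?_
    split_ifs with h
    · rfl
    · by_contra h0
      have hp : p ∈ v.support := DFinsupp.mem_support_iff.2 fun h => h0 h.symm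
      exact h ⟨Finset.mem_biUnion.2 ⟨v, hv, Finset.mem_union_left _ (Finset.mem_image_of_mem _ hp)⟩,
        Finset.mem_biUnion.2 ⟨v, hv, Finset.mem_union_right _ (Finset.mem_image_of_mem _ hp)⟩⟩

end Units

end TubeAlg

end

open Classical in
theorem mainTheorem3
    {k : Type w} [Field k] [IsAlgClosed k]
    {C : Type u} [Category.{v} C] [Abelian C] [Linear k C] [MonoidalCategory C]
    [MonoidalPreadditive C] [MonoidalLinear k C] [RigidCategory C]
    [LocallyFiniteCategory k C] [SemisimpleCategory C] [PivotalCategory C] [SphericalCategory k C]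
    (S : SimpleReps C)
    (J : Gam C → Gam C → Set C) (hJ : ∀ i j, ∀ x ∈ J i j, Homogeneous i j x)
    (hSJ : ∀ i j, S.carrier i j ⊆ J i j)
    (I : Gam C → Set C) (hI : ∀ i, ∀ a ∈ I i, Homogeneous i i a) :
    -- welding of homogeneous elements is given by the expected formula in any pairs of dual bases
    (∀ x y : Label J,
      (∀ t : Label S.carrier, Nonempty (DualBases k t.1 (x.obj ⊗ y.obj) t.obj)) ∧
      ∀ (a b c : C) (f : TubeHom a b x.obj) (g : TubeHom b c y.obj),
        (∀ (t : Label S.carrier) (B : DualBases k t.1 (x.obj ⊗ y.obj) t.obj),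
          weld k S hSJ a b c (DirectSum.lof k (Label J) (fun z => TubeHom a b z.obj) x f)
              (DirectSum.lof k (Label J) (fun z => TubeHom b c z.obj) y g) (t.incl hSJ) =
            (dimAt k x.1 x.obj * dimAt k y.1 y.obj) • B.resolve a c (glueTube f g)) ∧
        ∀ z : Label J, z ∉ Set.range (Label.incl hSJ) →
          weld k S hSJ a b c (DirectSum.lof k (Label J) (fun z => TubeHom a b z.obj) x f)
              (DirectSum.lof k (Label J) (fun z => TubeHom b c z.obj) y g) z = 0) ∧
    -- welding is associative
    (∀ (a b c d : C) (f : TubeSpace J a b) (g : TubeSpace J b c) (h : TubeSpace J c d),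
      weld k S hSJ a c d (weld k S hSJ a b c f g) h =
        weld k S hSJ a b d f (weld k S hSJ b c d g h)) ∧
    -- the product of the tube algebra is welding
    (∀ (a b c : DiagLabel I) (f : TubeSpace S.carrier a.obj b.obj)
        (g : TubeSpace S.carrier b.obj c.obj),
      tubeMul k S I (tubeIncl k S I a b f) (tubeIncl k S I b c g) =
        tubeIncl k S I a c (weld k S (fun _ _ => subset_rfl) a.obj b.obj c.obj f g)) ∧
    (∀ (a b b' c : DiagLabel I) (f : TubeSpace S.carrier a.obj b.obj)
        (g : TubeSpace S.carrier b'.obj c.obj), b ≠ b' →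
      tubeMul k S I (tubeIncl k S I a b f) (tubeIncl k S I b' c g) = 0) ∧
    -- the tube algebra is an associative algebra with local units
    IsAlgebraWithLocalUnits (tubeMul k S I) ∧
    -- the local units are the idempotents `e_F`
    (∀ F : Finset (DiagLabel I),
      tubeMul k S I (tubeUnitSum k S I F) (tubeUnitSum k S I F) = tubeUnitSum k S I F ∧
      ∀ (f : Tube S I) (p : DiagLabel I × DiagLabel I),
        tubeMul k S I (tubeMul k S I (tubeUnitSum k S I F) f) (tubeUnitSum k S I F) p =
          if p.1 ∈ F ∧ p.2 ∈ F then f p else 0) ∧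
    (∀ V : Submodule k (Tube S I), FiniteDimensional k V →
      ∃ F : Finset (DiagLabel I), ∀ v ∈ V,
        tubeMul k S I (tubeMul k S I (tubeUnitSum k S I F) v) (tubeUnitSum k S I F) = v) := by
  refine ⟨fun x y => ⟨fun t => S.nonempty_dualBases _ t, fun a b c f g => ⟨fun t B => ?_,
    fun z hz => weld_lof_lof_apply_of_notMem S hSJ x y f g z hz⟩⟩, fun a b c d f g h =>
    weld_assoc S hSJ a b c d f g h, tubeMul_incl_incl S I, tubeMul_incl_incl_of_ne S I,
    ⟨tubeMul_assoc S I, fun V _ => ?_⟩, fun F => ⟨tubeUnitSum_idem S hI F,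
    tubeUnitSum_mul_mul_apply S hI F⟩, fun V _ => exists_tubeUnitSum S hI V⟩
  · exact (weld_lof_lof_apply_incl S hSJ x y f g t).trans (weldAt_apply B f g)
  · obtain ⟨F, hF⟩ := exists_tubeUnitSum (k := k) S hI V
    exact ⟨tubeUnitSum k S I F, tubeUnitSum_idem S hI F, fun v hv => ⟨v, (hF v hv).symm⟩⟩
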